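/- Let $\mathfrak g$ be a finite-dimensional complex simple Lie algebra, $\mathfrak h$ a Cartan subalgebra, $\Pi=\{\alpha_1,\dots,\alpha_\ell\}$ a system of simple roots and $\psi$ the highest root. Write each root as $\varphi=\sum_j n_j(\varphi)\alpha_j$ with integers $n_j(\varphi)$, let $x_1,\dots,x_\ell\in\mathfrak h$ be the basis dual to $\Pi$, and fix $j\in\{1,\dots,\ell\}$. Put $n=n_j(\psi)$, $v_j=x_j/n$, $\omega=e^{2\pi i/n}$, and $a_j=\exp(2\pi i\,v_j)$ (an element of a maximal compact subgroup $K$ of the simply connected complex group with Lie algebra $\mathfrak g$), so that $\operatorname{Ad}a_j=\exp(2\pi i\operatorname{ad}v_j)$ on $\mathfrak g$. Let $\mathfrak g^{a_j}=\{z:\operatorname{Ad}a_j(z)=z\}$, let $\mathfrak m[j]$ be the centralizer of $x_j$ in $\mathfrak g$, let $\mathfrak r[j]$ be the orthocomplement of $\mathfrak g^{a_j}$ in $\mathfrak g$ for the Killing form, and put $\mathfrak g_{k\beta[j]}=\{z:[x_j,z]=kz\}$ for $k\in\mathbb Z$ and $\mathfrak g[a_j]^k=\{z:\operatorname{Ad}a_j(z)=\omega^kz\}$.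 A finite-dimensional module is called multiplicity-free if it is completely reducible and distinct irreducible submodules of it are inequivalent. Then: 1. $v_j$ is a vertex of the fundamental alcove $\{x\in\mathfrak h_{\mathbb R}:\langle\alpha_i,x\rangle\ge 0\ (i=1,\dots,\ell),\ \langle\psi,x\rangle\le 1\}$, where $\mathfrak h_{\mathbb R}\subset\mathfrak h$ is the real form on which all roots are real. The element $a_j$ is special, that is, $\mathfrak g^{a_j}$ is semisimple. If $n$ is prime, then $\mathfrak g^{a_j}$ is a maximal proper Lie subalgebra of $\mathfrak g$. 2. $\mathfrak m[j]$ is also the centralizer of $v_j$, and $\mathfrak m[j]\subseteq\mathfrak g^{a_j}$. The $\mathfrak m[j]$-module $\mathfrak r[j]$ is multiplicity-free, and $\mathfrak r[j]=\bigoplus_{1\le|k|\le n-1}\mathfrak g_{k\beta[j]}$ is its decomposition into $2(n-1)$ irreducible $\mathfrak m[j]$-submodules. 3. For $k=1,\dots,n-1$, $\mathfrak g[a_j]^k=\mathfrak g_{k\beta[j]}\oplus\mathfrak g_{(k-n)\beta[j]}$ is a decomposition into two irreducible $\mathfrak m[j]$-submodules, and $\mathfrak g[a_j]^k$ is an irreducible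 $\mathfrak g^{a_j}$-module. 4. The $\mathfrak g^{a_j}$-module $\mathfrak r[j]$ is multiplicity-free, and $\mathfrak r[j]=\bigoplus_{k=1}^{n-1}\mathfrak g[a_j]^k$ is its decomposition into $n-1$ irreducible $\mathfrak g^{a_j}$-submodules. 5. If $p,q,r\in\{1,\dots,n-1\}$ and $r\equiv p+q \bmod n$, then $[\mathfrak g[a_j]^p,\mathfrak g[a_j]^q]=\mathfrak g[a_j]^r$, where the left side is the linear span of the brackets. -/

import Mathlib

open Module LieAlgebra LieAlgebra.IsKilling

noncomputable section

namespace SpecialElement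

/-! ### The exponential of a linear endomorphism -/

section Exponential

variable {V : Type*} [AddCommGroup V] [Module ℂ V] [FiniteDimensional ℂ V]

/-- The exponential `∑ fᵐ / m!` of an endomorphism of a finite-dimensional complex vector space,
computed as the exponential of its matrix in a basis (the result does not depend on the basis). -/
def expEnd (f : End ℂ V) : End ℂ V :=
  Matrix.toLin (finBasis ℂ V) (finBasis ℂ V)
    (NormedSpace.exp (LinearMap.toMatrix (finBasis ℂ V) (finBasis ℂ V) f))

lemma exp_mulVec_of_eigenvector {d : ℕ} (A : Matrix (Fin d) (Fin d) ℂ) (v : Fin d → ℂ) (c : ℂ)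
    (h : A.mulVec v = c • v) : (NormedSpace.exp A).mulVec v = Complex.exp c • v := by
  let _ : NormedRing (Matrix (Fin d) (Fin d) ℂ) := Matrix.linftyOpNormedRing
  let _ : NormedAlgebra ℂ (Matrix (Fin d) (Fin d) ℂ) := Matrix.linftyOpNormedAlgebra
  have h1 : HasSum (fun m : ℕ => ((m.factorial : ℂ)⁻¹) • A ^ m) (NormedSpace.exp A) :=
    NormedSpace.exp_series_hasSum_exp' A
  let φ : Matrix (Fin d) (Fin d) ℂ →ₗ[ℂ] (Fin d → ℂ) := (Matrix.mulVecBilin ℂ ℂ).flip v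
  have h2 := h1.map φ φ.continuous_of_finiteDimensional
  have h3 : HasSum (fun m : ℕ => ((m.factorial : ℂ)⁻¹) • c ^ m) (NormedSpace.exp c) :=
    NormedSpace.exp_series_hasSum_exp' c
  have h4 := h3.smul_const v
  have hpow : ∀ m : ℕ, (A ^ m).mulVec v = c ^ m • v := by
    intro m
    induction m with
    | zero => simp
    | succ m ih =>
      rw [pow_succ, ← Matrix.mulVec_mulVec, h, Matrix.mulVec_smul, ih, smul_smul, pow_succ,
        mul_comm]
  rw [Complex.exp_eq_exp_ℂ]
  refine HasSum.unique h2 ?_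
  convert h4 using 2 with m
  simp [φ, hpow, smul_smul]

lemma expEnd_apply_of_eigenvector (f : End ℂ V) (v : V) (c : ℂ) (h : f v = c • v) :
    expEnd f v = Complex.exp c • v := by
  apply (finBasis ℂ V).equivFun.injective
  have e := exp_mulVec_of_eigenvector
    (LinearMap.toMatrix (finBasis ℂ V) (finBasis ℂ V) f) ((finBasis ℂ V).repr v) c (by
      rw [LinearMap.toMatrix_mulVec_repr, h]; simp)
  rw [expEnd, Matrix.toLin_apply]
  rw [e]
  ext i
  simp [Finsupp.single_apply]

end Exponential

section LieTheory

variable {L : Type*} [LieRing L] [LieAlgebra ℂ L]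

/-! ### Fixed subalgebras, centralizers, eigenspaces, orthocomplements -/

/-- The subalgebra `𝔤ᵃ` of fixed vectors of an automorphism `a` of `𝔤`. -/
def fixedSubalgebra (a : L ≃ₗ⁅ℂ⁆ L) : LieSubalgebra ℂ L where
  carrier := {z | a z = z}
  add_mem' {x y} hx hy := by simp only [Set.mem_ofPred_eq, map_add] at *; rw [hx, hy]
  zero_mem' := by simp
  smul_mem' c x hx := by simp only [Set.mem_ofPred_eq, map_smul] at *; rw [hx]
  lie_mem' {x y} hx hy := by
    change a x = x at hx
    change a y = y at hy
    change a ⁅x, y⁆ = ⁅x, y⁆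
    rw [LieEquiv.map_lie, hx, hy]

/-- The centralizer `𝔤ˣ` of an element `x` of `𝔤`. -/
def elemCentralizer (x : L) : LieSubalgebra ℂ L where
  carrier := {z | ⁅x, z⁆ = 0}
  add_mem' {y z} hy hz := by simp only [Set.mem_ofPred_eq, lie_add] at *; rw [hy, hz, add_zero]
  zero_mem' := by simp
  smul_mem' c z hz := by simp only [Set.mem_ofPred_eq, lie_smul] at *; rw [hz, smul_zero]
  lie_mem' {y z} hy hz := by
    change ⁅x, y⁆ = 0 at hy
    change ⁅x, z⁆ = 0 at hz
    change ⁅x, ⁅y, z⁆⁆ = 0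
    rw [leibniz_lie, hy, hz, zero_lie, lie_zero, add_zero]

/-- An automorphism `a` is special if the Lie algebra `𝔤ᵃ` is semisimple. -/
def IsSpecial (a : L ≃ₗ⁅ℂ⁆ L) : Prop := LieAlgebra.IsSemisimple ℂ (fixedSubalgebra a)

/-- The `c`-eigenspace of an automorphism `a`, as a module over `𝔤ᵃ`. -/
def eigenModule (a : L ≃ₗ⁅ℂ⁆ L) (c : ℂ) : LieSubmodule ℂ (fixedSubalgebra a) L where
  carrier := {z | a z = c • z}
  add_mem' {x y} hx hy := by
    simp only [Set.mem_ofPred_eq, map_add, smul_add] at *; rw [hx, hy]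
  zero_mem' := by simp
  smul_mem' d x hx := by
    simp only [Set.mem_ofPred_eq, map_smul] at *; rw [hx, smul_comm]
  lie_mem {x z} hz := by
    have hx : a (x : L) = x := x.2
    change a z = c • z at hz
    change a ⁅(x : L), z⁆ = c • ⁅(x : L), z⁆
    rw [LieEquiv.map_lie, hx, hz, lie_smul]

/-- The `c`-eigenspace of `ad x`, as a module over the centralizer of `x`. -/
def adEigenModule (x : L) (c : ℂ) : LieSubmodule ℂ (elemCentralizer x) L where
  carrier := {z | ⁅x, z⁆ = c • z}
  add_mem' {y z} hy hz := by
    simp only [Set.mem_ofPred_eq, lie_add, smul_add] at *; rw [hy, hz]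
  zero_mem' := by simp
  smul_mem' d z hz := by
    simp only [Set.mem_ofPred_eq, lie_smul] at *; rw [hz, smul_comm]
  lie_mem {y z} hz := by
    have hy : ⁅x, (y : L)⁆ = 0 := y.2
    change ⁅x, z⁆ = c • z at hz
    change ⁅x, ⁅(y : L), z⁆⁆ = c • ⁅(y : L), z⁆
    rw [leibniz_lie, hy, hz, zero_lie, zero_add, lie_smul]

/-- The orthocomplement of a subalgebra `K` of `𝔤` for the Killing form, as a `K`-module. -/
def killingOrtho (K : LieSubalgebra ℂ L) : LieSubmodule ℂ K L where
  carrier := {z | ∀ y ∈ K, killingForm ℂ L y z = 0}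
  add_mem' {y z} hy hz w hw := by rw [map_add, hy w hw, hz w hw, add_zero]
  zero_mem' w _ := map_zero _
  smul_mem' c z hz w hw := by rw [map_smul, hz w hw, smul_zero]
  lie_mem {y z} hz w hw := by
    change killingForm ℂ L w ⁅(y : L), z⁆ = 0
    rw [← LieModule.traceForm_apply_lie_apply]
    exact hz _ (K.lie_mem hw y.2)

/-- Restriction of a submodule of `𝔤` from a subalgebra to a smaller subalgebra. -/
def restrictTo {K K' : LieSubalgebra ℂ L} (h : K ≤ K') (N : LieSubmodule ℂ K' L) :
    LieSubmodule ℂ K L where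
  __ := N.toSubmodule
  lie_mem {x _} hz := N.lie_mem (x := ⟨x, h x.2⟩) hz

/-- `[U, W]`: the linear span of all brackets `[u, w]` with `u ∈ U`, `w ∈ W`. -/
def bracketSpan (U W : Submodule ℂ L) : Submodule ℂ L :=
  Submodule.span ℂ {z | ∃ u ∈ U, ∃ w ∈ W, ⁅u, w⁆ = z}

/-! ### Decompositions into irreducible modules -/

section Modules

variable {K : Type*} [LieRing K] [LieAlgebra ℂ K]
  {M : Type*} [AddCommGroup M] [Module ℂ M] [LieRingModule K M] [LieModule ℂ K M]

/-- The submodule `N` is the direct sum of the irreducible submodules `V i`. -/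
structure IsIrreducibleDecomposition {ι : Type*} (N : LieSubmodule ℂ K M)
    (V : ι → LieSubmodule ℂ K M) : Prop where
  irreducible (i : ι) : LieModule.IsIrreducible ℂ K (V i)
  independent : iSupIndep V
  iSup_eq : ⨆ i, V i = N

variable (K M) in
/-- A module is multiplicity-free if it is completely reducible and distinct irreducible submodules
are inequivalent (so every irreducible module occurs at most once). -/
def IsMultiplicityFree : Prop :=
  ComplementedLattice (LieSubmodule ℂ K M) ∧
    ∀ N N' : LieSubmodule ℂ K M, LieModule.IsIrreducible ℂ K N → LieModule.IsIrreducible ℂ K N' →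
      Nonempty (N ≃ₗ⁅ℂ, K⁆ N') → N = N'

end Modules

/-! ### The adjoint action of the torus -/

section CartanSubalgebra

variable [FiniteDimensional ℂ L] [IsKilling ℂ L] (H : LieSubalgebra ℂ L) [H.IsCartanSubalgebra]

lemma iSup_eigenspace_ad (h : H) : ⨆ c, (ad ℂ L (h : L)).eigenspace c = ⊤ :=
  (isSemisimple_ad_of_mem_isCartanSubalgebra h.2).iSup_eigenspace_eq_top

lemma expEnd_ad_lie (h : H) (y z : L) :
    expEnd (ad ℂ L (h : L)) ⁅y, z⁆ =
      ⁅expEnd (ad ℂ L (h : L)) y, expEnd (ad ℂ L (h : L)) z⁆ := by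
  have hy : y ∈ ⨆ c, (ad ℂ L (h : L)).eigenspace c := by rw [iSup_eigenspace_ad]; trivial
  have hz : z ∈ ⨆ c, (ad ℂ L (h : L)).eigenspace c := by rw [iSup_eigenspace_ad]; trivial
  induction hy using Submodule.iSup_induction' with
  | zero => simp
  | add y y' _ _ h1 h2 => rw [add_lie, map_add, map_add, add_lie, h1, h2]
  | mem c y hy =>
    induction hz using Submodule.iSup_induction' with
    | zero => simp
    | add z z' _ _ h1 h2 => rw [lie_add, map_add, map_add, lie_add, h1, h2]
    | mem d z hz =>
      rw [End.mem_eigenspace_iff] at hy hz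
      have hyz : ad ℂ L (h : L) ⁅y, z⁆ = (c + d) • ⁅y, z⁆ := by
        rw [ad_apply] at *
        rw [leibniz_lie, hy, hz, smul_lie, lie_smul, add_smul]
      rw [expEnd_apply_of_eigenvector _ _ _ hy, expEnd_apply_of_eigenvector _ _ _ hz,
        expEnd_apply_of_eigenvector _ _ _ hyz, smul_lie, lie_smul, smul_smul, Complex.exp_add]

lemma expEnd_ad_neg (h : H) (z : L) :
    expEnd (ad ℂ L (((-h : H)) : L)) (expEnd (ad ℂ L (h : L)) z) = z := by
  have hz : z ∈ ⨆ c, (ad ℂ L (h : L)).eigenspace c := by rw [iSup_eigenspace_ad]; trivial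
  induction hz using Submodule.iSup_induction' with
  | zero => simp
  | add z z' _ _ h1 h2 => rw [map_add, map_add, h1, h2]
  | mem d z hz =>
    rw [End.mem_eigenspace_iff] at hz
    have hz' : ad ℂ L (((-h : H)) : L) z = (-d) • z := by
      rw [ad_apply] at *
      simp [hz]
    rw [expEnd_apply_of_eigenvector _ _ _ hz, map_smul, expEnd_apply_of_eigenvector _ _ _ hz',
      smul_smul, ← Complex.exp_add, add_neg_cancel, Complex.exp_zero, one_smul]

/-- For `h` in the Cartan subalgebra, the automorphism `Ad (exp h) = exp (ad h)` of `𝔤`. -/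
def adExp (h : H) : L ≃ₗ⁅ℂ⁆ L where
  __ := expEnd (ad ℂ L (h : L))
  map_lie' {y z} := expEnd_ad_lie H h y z
  invFun := expEnd (ad ℂ L (((-h : H)) : L))
  left_inv z := expEnd_ad_neg H h z
  right_inv z := by simpa using expEnd_ad_neg H (-h) z

@[simp] lemma adExp_apply (h : H) (z : L) : adExp H h z = expEnd (ad ℂ L (h : L)) z := rfl

/-! ### Simple roots, the highest root, the fundamental alcove and its vertices -/

variable {H} (b : (rootSystem H).Base)

/-- The integers `n_j(φ)` with `φ = ∑ j, n_j(φ) α_j`, where the `α_j` are the simple roots. -/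
def rootCoeff (φ : H.root) (j : b.support) : ℤ :=
  b.toWeightBasisInt.repr ((rootSystem H).rootSpanMem ℤ φ) j

lemma root_eq_sum_rootCoeff (φ : H.root) :
    (rootSystem H).root φ = ∑ j : b.support, rootCoeff b φ j • (rootSystem H).root j := by
  have h := congrArg ((rootSystem H).rootSpan ℤ).subtype
    (b.toWeightBasisInt.sum_repr ((rootSystem H).rootSpanMem ℤ φ))
  rw [map_sum] at h
  simp only [map_smul, Submodule.subtype_apply,
    RootPairing.Base.coe_toWeightBasisInt_apply] at h
  exact h.symm

/-- `ψ` is the highest root: it is maximal for the partial order in which `φ ≥ ψ` means that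
`φ - ψ` is a sum of simple roots (for a simple Lie algebra there is exactly one such root). -/
def IsHighestRoot (ψ : H.root) : Prop :=
  ∀ φ : H.root, (rootSystem H).root φ - (rootSystem H).root ψ ∈
    AddSubmonoid.closure ((rootSystem H).root '' b.support) → φ = ψ

/-- The basis `x_j` of the Cartan subalgebra dual to the simple roots. -/
def fundCoweight (j : b.support) : H := (evalEquiv ℂ H).symm (b.toWeightBasis.coord j)

lemma root_fundCoweight_self (j : b.support) :
    (rootSystem H).root j (fundCoweight b j) = 1 := by
  rw [fundCoweight, apply_evalEquiv_symm_apply, Basis.coord_apply,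
    RootPairing.Base.toWeightBasis_repr_root, Finsupp.single_eq_same]

lemma root_fundCoweight_of_ne (i j : b.support) (h : i ≠ j) :
    (rootSystem H).root i (fundCoweight b j) = 0 := by
  rw [fundCoweight, apply_evalEquiv_symm_apply, Basis.coord_apply,
    RootPairing.Base.toWeightBasis_repr_root, Finsupp.single_eq_of_ne h.symm]

/-- The fundamental alcove: the points `x` of the real form of the Cartan subalgebra (on which all
roots are real) with `⟨α_i, x⟩ ≥ 0` for every simple root `α_i`, and `⟨ψ, x⟩ ≤ 1`. -/
def fundAlcove (ψ : H.root) : Set H :=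
  {x | (∀ φ : H.root, ((rootSystem H).root φ x).im = 0) ∧
    (∀ i : b.support, 0 ≤ ((rootSystem H).root i x).re) ∧ ((rootSystem H).root ψ x).re ≤ 1}

/-- The vertex `v_j = x_j / n_j(ψ)` of the fundamental alcove. -/
def alcoveVertex (ψ : H.root) (j : b.support) : H :=
  ((rootCoeff b ψ j : ℂ)⁻¹) • fundCoweight b j

/-- `Ad a_j`, where `a_j = exp (2πi v_j)`. -/
def adVertex (ψ : H.root) (j : b.support) : L ≃ₗ⁅ℂ⁆ L :=
  adExp H ((2 * Real.pi * Complex.I) • alcoveVertex b ψ j)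

/-- The root of unity `ω[j] = exp (2πi / n_j(ψ))`. -/
def omega (ψ : H.root) (j : b.support) : ℂ :=
  Complex.exp (2 * Real.pi * Complex.I / (rootCoeff b ψ j : ℂ))

/-- The Levi factor `𝔪[j]`: the centralizer of `x_j` in `𝔤`. -/
def levi (j : b.support) : LieSubalgebra ℂ L := elemCentralizer (fundCoweight b j : L)

lemma levi_le_fixedSubalgebra (ψ : H.root) (j : b.support) :
    levi b j ≤ fixedSubalgebra (adVertex b ψ j) := by
  intro z hz
  change ⁅(fundCoweight b j : L), z⁆ = 0 at hz
  change adVertex b ψ j z = z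
  have h : ad ℂ L (((2 * Real.pi * Complex.I) • alcoveVertex b ψ j : H) : L) z = (0 : ℂ) • z := by
    simp [alcoveVertex, hz]
  rw [adVertex, adExp_apply, expEnd_apply_of_eigenvector _ _ _ h, Complex.exp_zero, one_smul]

/-- The space `𝔤_{k β[j]} = {z | [x_j, z] = k z}`, which is the span of the root vectors of the
roots `φ` with `n_j(φ) = k` when `k ≠ 0`, as an `𝔪[j]`-module. -/
def gradedPiece (j : b.support) (k : ℤ) : LieSubmodule ℂ (levi b j) L :=
  adEigenModule (fundCoweight b j : L) k

/-- The eigenspace `𝔤[a_j]ᵏ` of `Ad a_j` for the eigenvalue `ω[j]ᵏ`, as a `𝔤^{a_j}`-module. -/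
def adVertexEigen (ψ : H.root) (j : b.support) (k : ℤ) :
    LieSubmodule ℂ (fixedSubalgebra (adVertex b ψ j)) L :=
  eigenModule (adVertex b ψ j) (omega b ψ j ^ k)

/-- The orthocomplement `𝔯[j]` of `𝔤^{a_j}` for the Killing form, as a `𝔤^{a_j}`-module. -/
def vertexOrtho (ψ : H.root) (j : b.support) :
    LieSubmodule ℂ (fixedSubalgebra (adVertex b ψ j)) L :=
  killingOrtho (fixedSubalgebra (adVertex b ψ j))

end CartanSubalgebra

end LieTheory

end SpecialElement

end

open SpecialElement

/-! Both 𝔪[j] and 𝔤^{a_j} contain the Cartan subalgebra `H`, so a submodule of 𝔤 over either one is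
the sum of its part in `H` and of root spaces, which are lines (`le_of_rootSupport_subset`). Since
[𝔤_α, 𝔤_β] ≠ 0 when α + β is a root, the roots occurring in a submodule are stable under adding and
subtracting roots of the subalgebra (`isStableUnder_rootSupport`). Irreducibility thus becomes
connectedness of a set of roots, where 𝔪[j] has the roots with n_j = 0 and 𝔤^{a_j} those with n ∣
n_j.

Let A be a nonempty set of roots of level n_j = k ≠ 0, stable under level 0. Its sum s is invariant
under the reflections in α_i, i ≠ j, hence orthogonal to these α_i, and (s, t) is n_j(t) times a
constant with the sign of k. If roots of level k were left over, their sum would pair positively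
with s, so some a ∈ A and some leftover c would pair positively; then a - c would be a root of level
0 and c would lie in A (`mem_of_isStableUnder_level`). The residue class of k mod n consists of the
levels k and k - n because |n_j| ≤ n. For a set stable under all roots with n ∣ n_j, the sum is also
orthogonal to a root of level n, so it vanishes and both levels occur
(`mem_of_isStableUnder_residue`).

The same sign argument on the levels p > 0 and q - n < 0 yields two roots whose sum is a root. The
bracket of the eigenspaces is therefore nonzero, and irreducibility of the target gives equality. If
n is prime, a subalgebra strictly above 𝔤^{a_j} contains one eigenspace with exponent k prime to n,
hence by brackets all of them.

Multiplicity-freeness holds because isomorphisms commute with `H` and roots have one-dimensional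
weight spaces. Semisimplicity and the vertex property both come from the fact that ψ and the α_i, i
≠ j, form a basis of the dual of 𝔥. -/

namespace RootPairing

variable {ι R M N : Type*} [Field R] [AddCommGroup M] [Module R M]
  [AddCommGroup N] [Module R N]

/-! ### Sets of roots stable under adding and subtracting given roots -/

section Stable

variable (P : RootPairing ι R M N)

lemma exists_root_eq_neg (i : ι) : ∃ k, P.root k = -P.root i := ⟨P.reflectionPerm i i, by simp⟩

lemma rootSpanMem_ne_zero [CharZero R] (i : ι) : P.rootSpanMem ℤ i ≠ 0 :=
  fun h ↦ P.ne_zero i (congrArg Subtype.val h)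

/-- `A` is stable under adding and subtracting the roots in `S`. -/
def IsStableUnder (A S : Set ι) : Prop :=
  ∀ a ∈ A, ∀ s ∈ S, ∀ k, (P.root k = P.root a + P.root s ∨ P.root k = P.root a - P.root s) → k ∈ A

variable {P}

/-- Steps can be reversed: a step from the complement into A could be undone inside A. -/
lemma IsStableUnder.diff {A S T : Set ι} (hA : P.IsStableUnder A S) (hT : P.IsStableUnder T S) :
    P.IsStableUnder (T \ A) S := by
  intro a ha s hs k hk
  refine ⟨hT a ha.1 s hs k hk, fun hkA ↦ ha.2 (hA k hkA s hs a ?_)⟩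
  rcases hk with hk | hk
  · right; rw [hk]; abel
  · left; rw [hk]; abel

lemma IsStableUnder.inter {A S T : Set ι} (hA : P.IsStableUnder A S) (hT : P.IsStableUnder T S) :
    P.IsStableUnder (A ∩ T) S :=
  fun a ha s hs k hk ↦ ⟨hA a ha.1 s hs k hk, hT a ha.2 s hs k hk⟩

lemma IsStableUnder.mono {A S T : Set ι} (hA : P.IsStableUnder A S) (h : T ⊆ S) :
    P.IsStableUnder A T :=
  fun a ha s hs k hk ↦ hA a ha s (h hs) k hk

/-- The reflected root differs from that of `a` by an integer multiple of the root of `s`, and root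
strings have no gaps, so it is reached by single steps without leaving `A`. -/
lemma IsStableUnder.reflectionPerm_mem [CharZero R] [Finite ι] [P.IsCrystallographic]
    {A S : Set ι} (hA : P.IsStableUnder A S) {a s : ι}
    (ha : a ∈ A) (hs : s ∈ S) (hli : LinearIndependent R ![P.root s, P.root a]) :
    P.reflectionPerm s a ∈ A := by
  have key : ∀ m : ℕ, (∀ k, P.root k = P.root a + (m : ℤ) • P.root s → k ∈ A) ∧
      (∀ k, P.root k = P.root a + (-m : ℤ) • P.root s → k ∈ A) := by
    intro m
    induction m with
    | zero =>
      have : ∀ k, P.root k = P.root a → k ∈ A := fun k hk ↦ P.root.injective hk ▸ ha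
      exact ⟨fun k hk ↦ this k (by simpa using hk), fun k hk ↦ this k (by simpa using hk)⟩
    | succ m ih =>
      constructor
      · intro k hk
        have h1 := (P.root_add_zsmul_mem_range_iff hli (z := ((m + 1 : ℕ) : ℤ))).mp ⟨k, hk⟩
        obtain ⟨l, hl⟩ := (P.root_add_zsmul_mem_range_iff hli (z := (m : ℤ))).mpr (by
          rw [Set.mem_Icc] at *; lia)
        refine hA l (ih.1 l hl) s hs k (.inl ?_)
        rw [hk, hl]; push_cast; module
      · intro k hk
        have h1 := (P.root_add_zsmul_mem_range_iff hli (z := -((m + 1 : ℕ) : ℤ))).mp ⟨k, hk⟩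
        obtain ⟨l, hl⟩ := (P.root_add_zsmul_mem_range_iff hli (z := -(m : ℤ))).mpr (by
          rw [Set.mem_Icc] at *; lia)
        refine hA l (ih.2 l hl) s hs k (.inr ?_)
        rw [hk, hl]; push_cast; module
  have h : P.root (P.reflectionPerm s a) = P.root a + (-P.pairingIn ℤ a s) • P.root s := by
    rw [root_reflectionPerm, neg_smul, reflection_apply_root' ℤ, sub_eq_add_neg]
  obtain ⟨m, hm | hm⟩ := Int.eq_nat_or_neg (-P.pairingIn ℤ a s)
  · exact (key m).1 _ (by rw [h, hm])
  · exact (key m).2 _ (by rw [h, hm])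

end Stable

/-! ### The positive definite form on the root lattice -/

section Form

variable [CharZero R] [Fintype ι] (P : RootPairing ι R M N) [P.IsCrystallographic]

/-- The canonical positive definite form on the root lattice. -/
noncomputable def latticeForm : LinearMap.BilinForm ℤ (P.rootSpan ℤ) := (P.posRootForm ℤ).posForm

lemma latticeForm_comm (x y : P.rootSpan ℤ) : P.latticeForm x y = P.latticeForm y x :=
  (P.posRootForm ℤ).isSymm_posForm.eq x y

lemma latticeForm_pos {x : P.rootSpan ℤ} (hx : x ≠ 0) : 0 < P.latticeForm x x :=
  P.posRootForm_posForm_pos_of_ne_zero ℤ hx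

lemma latticeForm_root_pos_iff (i j : ι) :
    0 < P.latticeForm (P.rootSpanMem ℤ i) (P.rootSpanMem ℤ j) ↔ 0 < P.pairingIn ℤ i j :=
  (P.posRootForm ℤ).zero_lt_apply_root_root_iff i j

lemma two_mul_latticeForm_root (i j : ι) :
    2 * P.latticeForm (P.rootSpanMem ℤ i) (P.rootSpanMem ℤ j) =
      P.pairingIn ℤ i j * P.latticeForm (P.rootSpanMem ℤ j) (P.rootSpanMem ℤ j) := by
  apply FaithfulSMul.algebraMap_injective ℤ R
  rw [map_mul, map_mul, map_ofNat, latticeForm, P.algebraMap_pairingIn,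
    algebraMap_posRootForm_posForm, algebraMap_posRootForm_posForm]
  exact (P.posRootForm ℤ).two_mul_apply_root_root i j

lemma latticeForm_root_neg_iff (i j : ι) :
    P.latticeForm (P.rootSpanMem ℤ i) (P.rootSpanMem ℤ j) < 0 ↔ P.pairingIn ℤ i j < 0 := by
  have h := P.two_mul_latticeForm_root i j
  have hj : 0 < P.latticeForm (P.rootSpanMem ℤ j) (P.rootSpanMem ℤ j) :=
    (P.posRootForm ℤ).zero_lt_posForm_apply_root j
  constructor <;> intro h' <;> nlinarith

/-- The sum of a reflection-invariant set of roots is orthogonal to the reflecting root. -/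
lemma latticeForm_sum_eq_zero (A : Finset ι) (i : ι) (hA : ∀ a ∈ A, P.reflectionPerm i a ∈ A) :
    P.latticeForm (∑ a ∈ A, P.rootSpanMem ℤ a) (P.rootSpanMem ℤ i) = 0 := by
  -- The reflection permutes `A` and changes the sign of the pairing with `i`, so the total equals
  -- its own negative.
  have h1 : ∑ a ∈ A, P.pairingIn ℤ a i = ∑ a ∈ A, -P.pairingIn ℤ a i := by
    refine Finset.sum_nbij' (P.reflectionPerm i) (P.reflectionPerm i) hA hA ?_ ?_ ?_
    · simp
    · simp
    · intro a _
      apply FaithfulSMul.algebraMap_injective ℤ R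
      rw [map_neg, P.algebraMap_pairingIn, P.algebraMap_pairingIn, ← P.pairing_reflectionPerm,
        pairing_reflectionPerm_self_right, neg_neg]
  have h2 : ∑ a ∈ A, P.pairingIn ℤ a i = 0 := by
    rw [Finset.sum_neg_distrib] at h1; lia
  have h3 : 2 * P.latticeForm (∑ a ∈ A, P.rootSpanMem ℤ a) (P.rootSpanMem ℤ i) = 0 := by
    rw [map_sum, LinearMap.sum_apply, Finset.mul_sum]
    simp_rw [two_mul_latticeForm_root]
    rw [← Finset.sum_mul, h2, zero_mul]
  lia

lemma exists_latticeForm_neg {A B : Finset ι}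
    (h : P.latticeForm (∑ a ∈ A, P.rootSpanMem ℤ a) (∑ a ∈ B, P.rootSpanMem ℤ a) < 0) :
    ∃ a ∈ A, ∃ c ∈ B, P.pairingIn ℤ a c < 0 := by
  by_contra! hc
  refine h.not_ge ?_
  rw [LinearMap.map_sum₂]
  refine Finset.sum_nonneg fun a ha ↦ ?_
  rw [map_sum]
  refine Finset.sum_nonneg fun c hc' ↦ ?_
  rw [← not_lt, latticeForm_root_neg_iff, not_lt]
  exact hc a ha c hc'

lemma exists_latticeForm_pos {A B : Finset ι}
    (h : 0 < P.latticeForm (∑ a ∈ A, P.rootSpanMem ℤ a) (∑ a ∈ B, P.rootSpanMem ℤ a)) :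
    ∃ a ∈ A, ∃ c ∈ B, 0 < P.pairingIn ℤ a c := by
  by_contra! hc
  refine h.not_ge ?_
  rw [LinearMap.map_sum₂]
  refine Finset.sum_nonpos fun a ha ↦ ?_
  rw [map_sum]
  refine Finset.sum_nonpos fun c hc' ↦ ?_
  rw [← not_lt, latticeForm_root_pos_iff, not_lt]
  exact hc a ha c hc'

end Form

/-! ### Coordinates with respect to the simple roots -/

namespace Base

variable [CharZero R] {P : RootPairing ι R M N} (b : P.Base)

/-- The coefficients of a root in terms of the simple roots. -/
noncomputable def simpleCoeff (i : ι) (j : b.support) : ℤ :=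
  b.toWeightBasisInt.repr (P.rootSpanMem ℤ i) j

lemma toWeightBasisInt_eq (i : b.support) : b.toWeightBasisInt i = P.rootSpanMem ℤ i :=
  Subtype.ext (by simp)

lemma simpleCoeff_simple [DecidableEq b.support] (i j : b.support) :
    b.simpleCoeff i j = if i = j then 1 else 0 := by
  rw [simpleCoeff, ← toWeightBasisInt_eq, Basis.repr_self, Finsupp.single_apply]

lemma simpleCoeff_of_add {i j k : ι} (h : P.root k = P.root i + P.root j) (l : b.support) :
    b.simpleCoeff k l = b.simpleCoeff i l + b.simpleCoeff j l := by
  have : P.rootSpanMem ℤ k = P.rootSpanMem ℤ i + P.rootSpanMem ℤ j := Subtype.ext h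
  simp only [simpleCoeff, this, map_add, Finsupp.add_apply]

lemma simpleCoeff_of_sub {i j k : ι} (h : P.root k = P.root i - P.root j) (l : b.support) :
    b.simpleCoeff k l = b.simpleCoeff i l - b.simpleCoeff j l := by
  have : P.rootSpanMem ℤ k = P.rootSpanMem ℤ i - P.rootSpanMem ℤ j := Subtype.ext h
  simp only [simpleCoeff, this, map_sub, Finsupp.sub_apply]

lemma simpleCoeff_of_neg {i k : ι} (h : P.root k = -P.root i) (l : b.support) :
    b.simpleCoeff k l = -b.simpleCoeff i l := by
  have : P.rootSpanMem ℤ k = -P.rootSpanMem ℤ i := Subtype.ext h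
  simp only [simpleCoeff, this, map_neg, Finsupp.neg_apply]

lemma eq_of_simpleCoeff_eq {i k : ι} (h : b.simpleCoeff i = b.simpleCoeff k) : i = k := by
  have : P.rootSpanMem ℤ i = P.rootSpanMem ℤ k :=
    b.toWeightBasisInt.repr.injective (DFunLike.coe_injective h)
  exact P.root.injective (congrArg Subtype.val this)

lemma mem_closure_iff {x : M} (hx : x ∈ P.rootSpan ℤ) :
    x ∈ AddSubmonoid.closure (P.root '' b.support) ↔
      ∀ j, 0 ≤ b.toWeightBasisInt.repr ⟨x, hx⟩ j := by
  constructor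
  · intro h
    induction h using AddSubmonoid.closure_induction with
    | mem x h =>
      classical
      obtain ⟨i, hi, rfl⟩ := h
      intro j
      have := b.simpleCoeff_simple ⟨i, hi⟩ j
      rw [simpleCoeff] at this
      change 0 ≤ b.toWeightBasisInt.repr (P.rootSpanMem ℤ i) j
      rw [this]; split_ifs <;> simp
    | zero => 
      intro j
      have : (⟨0, hx⟩ : P.rootSpan ℤ) = 0 := rfl
      simp [this]
    | add x y h1 h2 h3 h4 =>
      have e : AddSubmonoid.closure (P.root '' b.support) ≤ (P.rootSpan ℤ).toAddSubmonoid :=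
        AddSubmonoid.closure_le.mpr <| by
          rintro _ ⟨i, _, rfl⟩
          exact Submodule.subset_span ⟨i, rfl⟩
      intro j
      have : (⟨x + y, hx⟩ : P.rootSpan ℤ) =
          (⟨x, e h1⟩ : P.rootSpan ℤ) + (⟨y, e h2⟩ : P.rootSpan ℤ) := rfl
      rw [this, map_add, Finsupp.add_apply]
      exact add_nonneg (h3 _ j) (h4 _ j)
  · intro h
    have h1 := congrArg Subtype.val (b.toWeightBasisInt.sum_repr ⟨x, hx⟩)
    simp only [AddSubmonoidClass.coe_finsetSum, SetLike.val_smul, coe_toWeightBasisInt_apply]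
      at h1
    rw [← h1]
    refine AddSubmonoid.sum_mem _ fun i _ ↦ ?_
    obtain ⟨m, hm⟩ := Int.eq_ofNat_of_zero_le (h i)
    rw [hm, natCast_zsmul]
    exact AddSubmonoid.nsmul_mem _ (AddSubmonoid.subset_closure (Set.mem_image_of_mem _ i.2)) m

lemma repr_sum_rootSpanMem (A : Finset ι) (j : b.support) :
    b.toWeightBasisInt.repr (∑ a ∈ A, P.rootSpanMem ℤ a) j = ∑ a ∈ A, b.simpleCoeff a j := by
  simp [simpleCoeff]

lemma linearIndependent_of_simpleCoeff [P.IsReduced] {i k : ι} {j : b.support}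
    (h : b.simpleCoeff k j ≠ b.simpleCoeff i j) (h' : b.simpleCoeff k j ≠ -b.simpleCoeff i j) :
    LinearIndependent R ![P.root i, P.root k] :=
  IsReduced.linearIndependent P (fun e ↦ h (by rw [e])) fun e ↦ h' <|
    b.simpleCoeff_of_neg (by rw [e, neg_neg]) j

lemma isStableUnder_level (j : b.support) (k : ℤ) :
    P.IsStableUnder {i | b.simpleCoeff i j = k} {i | b.simpleCoeff i j = 0} := by
  intro a ha s hs l hl
  simp only [Set.mem_ofPred_eq] at *
  rcases hl with hl | hl
  · rw [b.simpleCoeff_of_add hl, ha, hs, add_zero]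
  · rw [b.simpleCoeff_of_sub hl, ha, hs, sub_zero]

variable [Fintype ι] [P.IsCrystallographic]

/-- If `s` is orthogonal to every simple root but the `j`-th one, then pairing with `s` is
determined by the `j`-th coordinate. -/
lemma latticeForm_mul_coord (j : b.support) {s : P.rootSpan ℤ}
    (hs : ∀ i : b.support, i ≠ j → P.latticeForm s (P.rootSpanMem ℤ i) = 0) (t : P.rootSpan ℤ) :
    P.latticeForm s t = b.toWeightBasisInt.repr t j * P.latticeForm s (P.rootSpanMem ℤ j) := by
  conv_lhs => rw [← b.toWeightBasisInt.sum_repr t]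
  rw [map_sum, Finset.sum_eq_single j]
  · rw [map_smul, toWeightBasisInt_eq, smul_eq_mul]
  · intro i _ hi
    rw [map_smul, toWeightBasisInt_eq, hs i hi, smul_zero]
  · simp

/-- Two lattice vectors orthogonal to every simple root but the `j`-th one are proportional. -/
lemma coord_mul_latticeForm (j : b.support) {s : P.rootSpan ℤ}
    (hs : ∀ i : b.support, i ≠ j → P.latticeForm s (P.rootSpanMem ℤ i) = 0) (t : P.rootSpan ℤ) :
    b.toWeightBasisInt.repr s j * P.latticeForm s t =
      b.toWeightBasisInt.repr t j * P.latticeForm s s := by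
  rw [b.latticeForm_mul_coord j hs t, b.latticeForm_mul_coord j hs s]
  ring

variable [P.IsReduced]

/-! ### Connectedness of levels and of residue classes -/

section Level

variable (j : b.support)

variable {j} in
lemma latticeForm_sum_level_eq_zero {k : ℤ} (hk : k ≠ 0) (A : Finset ι)
    (hA : P.IsStableUnder (A : Set ι) {i | b.simpleCoeff i j = 0})
    (hAk : ∀ a ∈ A, b.simpleCoeff a j = k) (i : b.support) (hi : i ≠ j) :
    P.latticeForm (∑ a ∈ A, P.rootSpanMem ℤ a) (P.rootSpanMem ℤ i) = 0 := by
  classical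
  have hi0 : b.simpleCoeff i j = 0 := by rw [simpleCoeff_simple, if_neg hi]
  refine P.latticeForm_sum_eq_zero A i fun a ha ↦ ?_
  refine hA.reflectionPerm_mem (s := (i : ι)) ha hi0
    (b.linearIndependent_of_simpleCoeff (j := j) ?_ ?_) <;> rw [hAk a ha, hi0] <;> simpa

/-- With s the sum over `A`, the witness is r = k (s, α_j), positive because |A| r = (s, s). The
factor `k` on the left makes one identity serve both signs of `k`; only `A` has to be stable. -/
lemma coord_mul_latticeForm_level {k l : ℤ} (hk : k ≠ 0) (A B : Finset ι) (hA₀ : A.Nonempty)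
    (hA : P.IsStableUnder (A : Set ι) {i | b.simpleCoeff i j = 0})
    (hAk : ∀ a ∈ A, b.simpleCoeff a j = k) (hBl : ∀ a ∈ B, b.simpleCoeff a j = l) :
    ∃ r : ℤ, 0 < r ∧ k * P.latticeForm (∑ a ∈ A, P.rootSpanMem ℤ a) (∑ a ∈ B, P.rootSpanMem ℤ a) =
      B.card * l * r := by
  set s := ∑ a ∈ A, P.rootSpanMem ℤ a with hs
  have h := b.coord_mul_latticeForm j (b.latticeForm_sum_level_eq_zero hk A hA hAk)
    (∑ a ∈ B, P.rootSpanMem ℤ a)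
  rw [repr_sum_rootSpanMem, repr_sum_rootSpanMem, Finset.sum_congr rfl hAk,
    Finset.sum_congr rfl hBl, Finset.sum_const, Finset.sum_const, nsmul_eq_mul, nsmul_eq_mul,
    ← hs] at h
  have hs0 : s ≠ 0 := by
    intro h0
    have h1 := b.repr_sum_rootSpanMem A j
    rw [← hs, h0, Finset.sum_congr rfl hAk, Finset.sum_const, nsmul_eq_mul] at h1
    simp [hk, hA₀.ne_empty] at h1
  have hc : (0 : ℤ) < A.card := by exact_mod_cast hA₀.card_pos
  have hss := P.latticeForm_pos hs0
  have hd : P.latticeForm s s = A.card * (k * P.latticeForm s (P.rootSpanMem ℤ j)) := by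
    have h1 := b.latticeForm_mul_coord j (b.latticeForm_sum_level_eq_zero hk A hA hAk) s
    rw [← hs] at h1
    conv_lhs => rw [h1]
    rw [hs, repr_sum_rootSpanMem, Finset.sum_congr rfl hAk, Finset.sum_const, nsmul_eq_mul]
    ring
  refine ⟨k * P.latticeForm s (P.rootSpanMem ℤ j), ?_, ?_⟩
  · rw [hd] at hss
    exact pos_of_mul_pos_right hss hc.le
  · apply mul_left_cancel₀ hc.ne'
    rw [hd] at h
    linear_combination h

/-- The roots whose `j`-th coordinate is a fixed nonzero integer are connected by roots whose
`j`-th coordinate is zero. -/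
theorem mem_of_isStableUnder_level {k : ℤ} (hk : k ≠ 0) {A : Set ι} (hA₀ : A.Nonempty)
    (hA : P.IsStableUnder A {i | b.simpleCoeff i j = 0})
    (hAk : ∀ a ∈ A, b.simpleCoeff a j = k) {i : ι} (hi : b.simpleCoeff i j = k) : i ∈ A := by
  classical
  by_contra hiA
  have hB := hA.diff (b.isStableUnder_level j k)
  -- Compare `A` with its complement in level `k`: here l = k, so the pairing of the two sums is |B|
  -- r > 0.
  have hAB := (b.coord_mul_latticeForm_level j hk (A := A.toFinset)
    (B := ({i | b.simpleCoeff i j = k} \ A).toFinset) (by simpa) (by simpa) (by simpa)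
    (l := k) (by simp +contextual))
  obtain ⟨r, hr, h⟩ := hAB
  have hcard : (0 : ℤ) < (({i | b.simpleCoeff i j = k} \ A).toFinset.card : ℤ) := by
    exact_mod_cast Finset.card_pos.mpr ⟨i, by simp [hi, hiA]⟩
  have hpos : 0 < P.latticeForm (∑ a ∈ A.toFinset, P.rootSpanMem ℤ a)
      (∑ a ∈ ({i | b.simpleCoeff i j = k} \ A).toFinset, P.rootSpanMem ℤ a) := by
    have : P.latticeForm (∑ a ∈ A.toFinset, P.rootSpanMem ℤ a)
      (∑ a ∈ ({i | b.simpleCoeff i j = k} \ A).toFinset, P.rootSpanMem ℤ a) =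
        (({i | b.simpleCoeff i j = k} \ A).toFinset.card : ℤ) * r := by
      apply mul_left_cancel₀ hk
      linear_combination h
    rw [this]
    exact mul_pos hcard hr
  obtain ⟨a, ha, c, hc, hac⟩ := P.exists_latticeForm_pos hpos
  rw [Set.mem_toFinset] at ha hc
  obtain ⟨d, hd⟩ := P.root_sub_root_mem_of_pairingIn_pos hac fun e ↦ hc.2 (e ▸ ha)
  refine hc.2 (hA a ha d ?_ c (.inr (by rw [hd]; abel)))
  change b.simpleCoeff d j = 0
  rw [b.simpleCoeff_of_sub hd, hAk a ha, hc.1, sub_self]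

/-- Roots on levels of opposite sign which do not sum to zero contain a pair whose sum is
a root. -/
theorem exists_root_eq_add_of_level {k l : ℤ} (hk : 0 < k) (hl : l < 0) (hkl : k + l ≠ 0)
    (hk' : ∃ i, b.simpleCoeff i j = k) (hl' : ∃ i, b.simpleCoeff i j = l) :
    ∃ a c d, b.simpleCoeff a j = k ∧ b.simpleCoeff c j = l ∧ P.root d = P.root a + P.root c := by
  classical
  obtain ⟨i, hi⟩ := hk'
  obtain ⟨i', hi'⟩ := hl'
  obtain ⟨r, hr, h⟩ := b.coord_mul_latticeForm_level j hk.ne'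
    (A := {i | b.simpleCoeff i j = k}.toFinset) (B := {i | b.simpleCoeff i j = l}.toFinset)
    ⟨i, by simpa⟩ (by simpa using b.isStableUnder_level j k) (by simp) (l := l) (by simp)
  have hcard : (0 : ℤ) < ({i | b.simpleCoeff i j = l}.toFinset.card : ℤ) := by
    exact_mod_cast Finset.card_pos.mpr ⟨i', by simp [hi']⟩
  have hneg := neg_of_mul_neg_right (h.trans_lt (by nlinarith [mul_pos hcard hr])) hk.le
  obtain ⟨a, ha, c, hc, hac⟩ := P.exists_latticeForm_neg hneg
  simp only [Set.mem_toFinset, Set.mem_ofPred_eq] at ha hc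
  obtain ⟨d, hd⟩ := P.root_add_root_mem_of_pairingIn_neg hac fun e ↦ hkl (by
    rw [← ha, ← hc, b.simpleCoeff_of_neg e j]; ring)
  exact ⟨a, c, d, ha, hc, hd⟩

/-- The roots whose `j`-th coordinate lies in a fixed nonzero residue class modulo `n` are
connected by roots whose `j`-th coordinate is divisible by `n`, if `n` is attained. -/
theorem mem_of_isStableUnder_residue {n k : ℤ} (hn : ∃ i, b.simpleCoeff i j = n)
    (hk : 1 ≤ k) (hkn : k ≤ n - 1) {A : Set ι}
    (hA₀ : A.Nonempty) (hA : P.IsStableUnder A {i | n ∣ b.simpleCoeff i j})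
    (hAk : ∀ a ∈ A, b.simpleCoeff a j = k ∨ b.simpleCoeff a j = k - n) {i : ι}
    (hi : b.simpleCoeff i j = k ∨ b.simpleCoeff i j = k - n) : i ∈ A := by
  classical
  have hlev (m : ℤ) : P.IsStableUnder (A ∩ {i | b.simpleCoeff i j = m})
      {i | b.simpleCoeff i j = 0} :=
    (hA.mono fun s (hs : b.simpleCoeff s j = 0) ↦ by simp [hs]).inter (b.isStableUnder_level j m)
  have horth (s : ι) (hs : n ∣ b.simpleCoeff s j) :
      P.latticeForm (∑ a ∈ A.toFinset, P.rootSpanMem ℤ a) (P.rootSpanMem ℤ s) = 0 := by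
    refine P.latticeForm_sum_eq_zero _ s fun a ha ↦ ?_
    rw [Set.mem_toFinset] at ha ⊢
    have hnd : ¬ n ∣ b.simpleCoeff a j := by
      rcases hAk a ha with h | h <;> rw [h]
      · exact fun h ↦ by have := Int.le_of_dvd (by lia) h; lia
      · intro h
        have h := (Int.dvd_neg.mpr h)
        have := Int.le_of_dvd (by lia) h; lia
    refine hA.reflectionPerm_mem (S := {i | n ∣ b.simpleCoeff i j}) ha hs
      (b.linearIndependent_of_simpleCoeff (j := j) ?_ ?_)
    · intro e; exact hnd (e ▸ hs)
    · intro e; exact hnd (e ▸ Int.dvd_neg.mpr hs)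
  set s := ∑ a ∈ A.toFinset, P.rootSpanMem ℤ a with hs
  -- A root of level n together with the α_i, i ≠ j, spans the lattice rationally. As s is
  -- orthogonal to all of these, (s, s) = 0.
  have hs0 : s = 0 := by
    by_contra h0
    have hc := b.latticeForm_mul_coord j (s := s) fun i hi ↦ horth i (by
      rw [simpleCoeff_simple, if_neg hi]; exact dvd_zero n)
    obtain ⟨i, hi⟩ := hn
    have h1 := hc (P.rootSpanMem ℤ i)
    rw [horth i (by rw [hi])] at h1
    change 0 = b.simpleCoeff i j * _ at h1
    rw [hi, eq_comm, mul_eq_zero, or_iff_right (by lia)] at h1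
    have h2 := hc s
    rw [h1, mul_zero] at h2
    exact (P.latticeForm_pos h0).ne' h2
  -- The levels sum to zero while k > 0 > k - n, so each of the two levels meets `A`.
  have hsum : ∑ a ∈ A.toFinset, b.simpleCoeff a j = 0 := by
    rw [← b.repr_sum_rootSpanMem, ← hs, hs0]; simp
  have hpos : ∃ a ∈ A, b.simpleCoeff a j = k := by
    by_contra! hc
    have : ∑ a ∈ A.toFinset, b.simpleCoeff a j < 0 := by
      refine Finset.sum_neg (fun a ha ↦ ?_) (by simpa)
      rw [Set.mem_toFinset] at ha
      have := (hAk a ha).resolve_left (hc a ha)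
      lia
    lia
  have hneg : ∃ a ∈ A, b.simpleCoeff a j = k - n := by
    by_contra! hc
    have : 0 < ∑ a ∈ A.toFinset, b.simpleCoeff a j := by
      refine Finset.sum_pos (fun a ha ↦ ?_) (by simpa)
      rw [Set.mem_toFinset] at ha
      have := (hAk a ha).resolve_right (hc a ha)
      lia
    lia
  rcases hi with hi | hi
  · obtain ⟨a, ha, hak⟩ := hpos
    exact (b.mem_of_isStableUnder_level j (by lia) (A := A ∩ {i | b.simpleCoeff i j = k})
      ⟨a, ha, hak⟩
      (hlev k) (fun a ha ↦ ha.2) hi).1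
  · obtain ⟨a, ha, hak⟩ := hneg
    exact (b.mem_of_isStableUnder_level j (by lia) (A := A ∩ {i | b.simpleCoeff i j = k - n})
      ⟨a, ha, hak⟩
      (hlev _) (fun a ha ↦ ha.2) hi).1

end Level

end Base
end RootPairing

/-! ### Maximal roots and the levels that occur -/

namespace RootPairing.Base

variable {ι R M N : Type*} [Fintype ι] [Field R] [CharZero R] [AddCommGroup M] [Module R M]
  [AddCommGroup N] [Module R N] {P : RootPairing ι R M N} (b : P.Base)
  [P.IsCrystallographic] [P.IsReduced]

/-- A root which is maximal for the order induced by the base. -/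
def IsMaximalRoot (p : ι) : Prop :=
  ∀ i, P.root i - P.root p ∈ AddSubmonoid.closure (P.root '' b.support) → i = p

omit [Fintype ι] [P.IsCrystallographic] [P.IsReduced] in
lemma sub_mem_closure_iff (i k : ι) :
    P.root i - P.root k ∈ AddSubmonoid.closure (P.root '' b.support) ↔
      ∀ j, b.simpleCoeff k j ≤ b.simpleCoeff i j := by
  rw [b.mem_closure_iff (sub_mem (P.rootSpanMem ℤ i).2 (P.rootSpanMem ℤ k).2)]
  have : (⟨P.root i - P.root k, sub_mem (P.rootSpanMem ℤ i).2 (P.rootSpanMem ℤ k).2⟩ :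
    P.rootSpan ℤ) = P.rootSpanMem ℤ i - P.rootSpanMem ℤ k := rfl
  simp only [this, map_sub, Finsupp.sub_apply, sub_nonneg]
  rfl

omit [Fintype ι] [P.IsCrystallographic] [P.IsReduced] in
lemma simpleCoeff_nonneg_or_nonpos (i : ι) :
    (∀ j, 0 ≤ b.simpleCoeff i j) ∨ ∀ j, b.simpleCoeff i j ≤ 0 := by
  rcases b.root_mem_or_neg_mem i with h | h
  · exact .inl ((b.mem_closure_iff (P.rootSpanMem ℤ i).2).mp h)
  · right
    intro j
    have := (b.mem_closure_iff (neg_mem (P.rootSpanMem ℤ i).2)).mp h j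
    have e : (⟨-P.root i, neg_mem (P.rootSpanMem ℤ i).2⟩ : P.rootSpan ℤ) =
      -P.rootSpanMem ℤ i := rfl
    rw [e, map_neg, Finsupp.neg_apply] at this
    exact neg_nonneg.mp this

omit [Fintype ι] [P.IsCrystallographic] [P.IsReduced] in
/-- Every root lies below a maximal one. -/
lemma exists_isMaximalRoot [Finite ι] (i : ι) :
    ∃ p, b.IsMaximalRoot p ∧ ∀ j, b.simpleCoeff i j ≤ b.simpleCoeff p j := by
  obtain ⟨x, hix, ⟨⟨p, rfl⟩, hp⟩⟩ :=
    (Set.finite_range b.simpleCoeff).exists_le_maximal (Set.mem_range_self i)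
  refine ⟨p, fun k hk ↦ ?_, hix⟩
  rw [sub_mem_closure_iff] at hk
  exact b.eq_of_simpleCoeff_eq (le_antisymm (hp ⟨k, rfl⟩ hk) hk)

omit [P.IsReduced] in
lemma latticeForm_rootSpanMem (x : P.rootSpan ℤ) (i : ι) :
    P.latticeForm x (P.rootSpanMem ℤ i) =
      ∑ j : b.support, b.simpleCoeff i j * P.latticeForm x (P.rootSpanMem ℤ j) := by
  conv_lhs => rw [← b.toWeightBasisInt.sum_repr (P.rootSpanMem ℤ i)]
  rw [map_sum]
  refine Finset.sum_congr rfl fun j _ ↦ ?_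
  rw [map_smul, toWeightBasisInt_eq, smul_eq_mul]
  rfl

namespace IsMaximalRoot

variable {b} {p : ι} (hp : b.IsMaximalRoot p)
include hp

omit [P.IsReduced] in
lemma latticeForm_nonneg (i : b.support) :
    0 ≤ P.latticeForm (P.rootSpanMem ℤ p) (P.rootSpanMem ℤ i) := by
  rw [← not_lt, latticeForm_root_neg_iff]
  intro h
  have hi : P.root i ∈ AddSubmonoid.closure (P.root '' b.support) :=
    AddSubmonoid.subset_closure ⟨i, i.2, rfl⟩
  -- If p = -α_i, then α_i - p = 2α_i is a sum of simple roots, and maximality would give α_i = p =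
  -- -α_i.
  have hne : P.root p ≠ -P.root i := by
    intro e
    have := hp i (by rw [e, sub_neg_eq_add]; exact add_mem hi hi)
    rw [← this, eq_comm, ← add_eq_zero_iff_neg_eq, ← two_smul R] at e
    simp [P.ne_zero] at e
  obtain ⟨k, hk⟩ := P.root_add_root_mem_of_pairingIn_neg h hne
  have := hp k (by rw [hk, add_sub_cancel_left]; exact hi)
  rw [this] at hk
  exact P.ne_zero i (left_eq_add.mp hk)

omit [P.IsReduced] in
lemma simpleCoeff_nonneg (j : b.support) : 0 ≤ b.simpleCoeff p j := by
  refine (b.simpleCoeff_nonneg_or_nonpos p).resolve_right (fun h ↦ ?_) j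
  refine (P.latticeForm_pos (P.rootSpanMem_ne_zero p)).not_ge ?_
  rw [b.latticeForm_rootSpanMem]
  exact Finset.sum_nonpos fun i _ ↦ mul_nonpos_of_nonpos_of_nonneg (h i) (hp.latticeForm_nonneg i)

omit [P.IsReduced] in
lemma exists_latticeForm_pos :
    ∃ i : b.support, 0 < P.latticeForm (P.rootSpanMem ℤ p) (P.rootSpanMem ℤ i) := by
  by_contra! h
  refine (P.latticeForm_pos (P.rootSpanMem_ne_zero p)).not_ge ?_
  rw [b.latticeForm_rootSpanMem]
  exact Finset.sum_nonpos fun i _ ↦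
    mul_nonpos_of_nonneg_of_nonpos (hp.simpleCoeff_nonneg i) (h i)

/-- All the coefficients of a maximal root of an irreducible root system are positive. -/
lemma simpleCoeff_pos [P.IsIrreducible] (j : b.support) : 0 < b.simpleCoeff p j := by
  classical
  obtain ⟨i, hi⟩ : ∃ i, 0 < b.simpleCoeff p i := by
    by_contra! h
    refine (P.latticeForm_pos (P.rootSpanMem_ne_zero p)).not_ge ?_
    rw [b.latticeForm_rootSpanMem]
    exact Finset.sum_nonpos fun i _ ↦
      mul_nonpos_of_nonpos_of_nonneg (h i) (hp.latticeForm_nonneg i)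
  -- Positivity spreads along the Dynkin diagram: if the coefficient at k vanished next to a
  -- positive one at i, no term of (α_k, p) would be positive and the i-th would be negative, so p
  -- would pair negatively with α_k.
  refine b.induction_on_cartanMatrix (fun i ↦ 0 < b.simpleCoeff p i) hi fun i k hi hik ↦ ?_
  by_contra hk
  replace hk : b.simpleCoeff p k = 0 := le_antisymm (not_lt.mp hk) (hp.simpleCoeff_nonneg k)
  have hne : (k : ι) ≠ i := by rintro e; rw [Subtype.ext e] at hk; lia
  refine (hp.latticeForm_nonneg k).not_gt ?_
  rw [P.latticeForm_comm, b.latticeForm_rootSpanMem]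
  have hle (l : b.support) : b.simpleCoeff p l *
      P.latticeForm (P.rootSpanMem ℤ k) (P.rootSpanMem ℤ l) ≤ 0 := by
    rcases eq_or_ne k l with rfl | hl
    · rw [hk, zero_mul]
    · refine mul_nonpos_of_nonneg_of_nonpos (hp.simpleCoeff_nonneg l) ?_
      rw [← not_lt, latticeForm_root_pos_iff, not_lt]
      exact b.pairingIn_le_zero_of_ne (fun e ↦ hl (Subtype.ext e)) k.2 l.2
  refine Finset.sum_neg' (fun l _ ↦ hle l) ⟨i, Finset.mem_univ i, mul_neg_of_pos_of_neg hi ?_⟩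
  rw [latticeForm_root_neg_iff]
  exact lt_of_le_of_ne (b.pairingIn_le_zero_of_ne hne k.2 i.2) hik

/-- In an irreducible root system the maximal root is unique. -/
lemma eq [P.IsIrreducible] {q : ι} (hq : b.IsMaximalRoot q) : p = q := by
  by_contra hne
  -- Since (p, q) > 0, the difference p - q is a root; whichever sign it has, it contradicts the
  -- maximality of q or of p.
  have hpos : 0 < P.latticeForm (P.rootSpanMem ℤ p) (P.rootSpanMem ℤ q) := by
    rw [b.latticeForm_rootSpanMem]
    obtain ⟨i, hi⟩ := hp.exists_latticeForm_pos
    exact Finset.sum_pos' (fun l _ ↦ mul_nonneg (hq.simpleCoeff_nonneg l) (hp.latticeForm_nonneg l))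
      ⟨i, Finset.mem_univ i, mul_pos (hq.simpleCoeff_pos i) hi⟩
  rw [latticeForm_root_pos_iff] at hpos
  obtain ⟨k, hk⟩ := P.root_sub_root_mem_of_pairingIn_pos hpos hne
  rcases b.root_mem_or_neg_mem k with h | h
  · exact hne (hq p (hk ▸ h))
  · rw [hk, neg_sub] at h
    exact hne (hp q h).symm

lemma simpleCoeff_le [P.IsIrreducible] (i : ι) (j : b.support) :
    b.simpleCoeff i j ≤ b.simpleCoeff p j := by
  obtain ⟨q, hq, h⟩ := b.exists_isMaximalRoot i
  exact (hp.eq hq) ▸ h j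

lemma abs_simpleCoeff_le [P.IsIrreducible] (i : ι) (j : b.support) :
    |b.simpleCoeff i j| ≤ b.simpleCoeff p j := by
  obtain ⟨k, hk⟩ := P.exists_root_eq_neg i
  have h := hp.simpleCoeff_le k j
  rw [b.simpleCoeff_of_neg hk] at h
  exact abs_le.mpr ⟨by lia, hp.simpleCoeff_le i j⟩

end IsMaximalRoot

omit [P.IsReduced] in
lemma exists_simpleCoeff_eq_of_pos {i : ι} {j : b.support} {k : ℤ} (hk : 0 < k)
    (hki : k ≤ b.simpleCoeff i j) : ∃ a, b.simpleCoeff a j = k := by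
  classical
  -- Adding a simple root changes the coordinate by 0 or 1, so no positive level is skipped. The
  -- claim is carried for both signs because the induction also passes to negative roots.
  refine b.induction_add i (p := fun i ↦ (∀ k, 0 < k → k ≤ b.simpleCoeff i j →
    ∃ a, b.simpleCoeff a j = k) ∧ ∀ k, 0 < k → k ≤ -b.simpleCoeff i j →
    ∃ a, b.simpleCoeff a j = k) ?_ ?_ ?_ |>.1 k hk hki
  · intro i ⟨h1, h2⟩
    have := b.simpleCoeff_of_neg (i := i) (k := P.reflectionPerm i i) (by simp) j
    rw [this, neg_neg]
    exact ⟨h2, h1⟩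
  · intro i hi
    have := b.simpleCoeff_simple ⟨i, hi⟩ j
    refine ⟨fun k hk hki ↦ ⟨i, ?_⟩, fun k hk hki ↦ ?_⟩
    · change b.simpleCoeff i j = _ at this
      split_ifs at this <;> lia
    · change b.simpleCoeff i j = _ at this
      split_ifs at this <;> lia
  · intro i s k hadd ⟨h1, h2⟩ hs
    have h := b.simpleCoeff_simple ⟨s, hs⟩ j
    have hk := b.simpleCoeff_of_add hadd j
    change b.simpleCoeff s j = _ at h
    constructor
    · intro l hl hlk
      rcases hlk.eq_or_lt with e | hlt
      · exact ⟨k, e.symm⟩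
      · exact h1 l hl (by split_ifs at h <;> lia)
    · intro l hl hlk
      exact h2 l hl (by split_ifs at h <;> lia)

omit [P.IsReduced] in
/-- Every nonzero integer between `-n` and `n`, where `n` is the `j`-th coordinate of a root,
is the `j`-th coordinate of a root. -/
lemma exists_simpleCoeff_eq {i : ι} {j : b.support} {k : ℤ} (hk : k ≠ 0)
    (hki : |k| ≤ b.simpleCoeff i j) : ∃ a, b.simpleCoeff a j = k := by
  rw [abs_le] at hki
  rcases hk.lt_or_gt with h | h
  · obtain ⟨a, ha⟩ := b.exists_simpleCoeff_eq_of_pos (k := -k) (by lia)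
      (show -k ≤ b.simpleCoeff i j by lia)
    obtain ⟨c, hc⟩ := P.exists_root_eq_neg a
    exact ⟨c, by rw [b.simpleCoeff_of_neg hc, ha, neg_neg]⟩
  · exact b.exists_simpleCoeff_eq_of_pos h hki.2

end RootPairing.Base

namespace SpecialElement

/-! ### Irreducible submodules and complements -/

section Modules

variable {L : Type*} [LieRing L] [LieAlgebra ℂ L] {K : LieSubalgebra ℂ L}

lemma coe_mem_map_incl_iff {N : LieSubmodule ℂ K L} {A : LieSubmodule ℂ K N} {z : N} :
    (z : L) ∈ A.map N.incl ↔ z ∈ A :=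
  ⟨fun ⟨_, hy, hyz⟩ ↦ (Subtype.ext hyz) ▸ hy, fun h ↦ ⟨z, h, rfl⟩⟩

lemma map_incl_injective (N : LieSubmodule ℂ K L) :
    Function.Injective (LieSubmodule.map N.incl : LieSubmodule ℂ K N → LieSubmodule ℂ K L) := by
  intro A B hAB
  ext z
  rw [← coe_mem_map_incl_iff, ← coe_mem_map_incl_iff, hAB]

lemma isIrreducible_of_forall_le {N : LieSubmodule ℂ K L} (hN : N ≠ ⊥)
    (h : ∀ N' ≤ N, N' ≠ ⊥ → N ≤ N') : LieModule.IsIrreducible ℂ K N := by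
  have : Nontrivial N := (LieSubmodule.nontrivial_iff_ne_bot ℂ K L).mpr hN
  refine LieModule.IsIrreducible.mk fun N' hN' ↦ ?_
  have h1 := h (N'.map N.incl) LieSubmodule.map_incl_le fun h ↦
    hN' (map_incl_injective N (by rw [h, LieSubmodule.map_bot]))
  exact eq_top_iff.mpr fun z _ ↦ coe_mem_map_incl_iff.mp (h1 z.2)

lemma le_of_isIrreducible {N N' : LieSubmodule ℂ K L} (hN : LieModule.IsIrreducible ℂ K N)
    (h : N ⊓ N' ≠ ⊥) : N ≤ N' := by
  rcases hN.eq_bot_or_eq_top (N'.comap N.incl) with h1 | h1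
  · refine absurd ?_ h
    rw [eq_bot_iff]
    rintro z ⟨hz, hz'⟩
    have : (⟨z, hz⟩ : N) ∈ N'.comap N.incl := hz'
    rw [h1, LieSubmodule.mem_bot] at this
    exact congrArg Subtype.val this
  · intro z hz
    have : (⟨z, hz⟩ : N) ∈ N'.comap N.incl := h1 ▸ LieSubmodule.mem_top _
    exact this

/-- The summands become atoms in the submodule lattice of `N`, and their supremum is everything. -/
lemma complementedLattice_of_isIrreducibleDecomposition {ι : Type*} {N : LieSubmodule ℂ K L}
    {V : ι → LieSubmodule ℂ K L} (hV : IsIrreducibleDecomposition N V) :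
    ComplementedLattice (LieSubmodule ℂ K N) := by
  have hle (i : ι) : V i ≤ N := hV.iSup_eq ▸ le_iSup V i
  have hmap (i : ι) : ((V i).comap N.incl).map N.incl = V i := by
    refine le_antisymm (LieSubmodule.map_comap_le _ _) fun z hz ↦ ?_
    exact ⟨⟨z, hle i hz⟩, hz, rfl⟩
  have hinj := map_incl_injective N
  have hatom (i : ι) : IsAtom ((V i).comap N.incl) := by
    refine ⟨fun h ↦ ?_, fun A hA ↦ ?_⟩
    · have h1 := hmap i
      rw [h, LieSubmodule.map_bot] at h1
      have := hV.irreducible i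
      have := LieModule.nontrivial_of_isIrreducible ℂ K (V i)
      exact (LieSubmodule.nontrivial_iff_ne_bot ℂ K L).mp this h1.symm
    · by_contra hA0
      have h1 : A.map N.incl ≤ V i := hmap i ▸ LieSubmodule.map_mono hA.le
      have h2 : V i ≤ A.map N.incl := by
        refine le_of_isIrreducible (hV.irreducible i) ?_
        rw [inf_eq_right.mpr h1]
        intro h
        exact hA0 (hinj (by rw [h, LieSubmodule.map_bot]))
      exact hA.not_ge fun z hz ↦ coe_mem_map_incl_iff.mp (h2 hz)
  refine complementedLattice_of_sSup_atoms_eq_top (eq_top_iff.mpr ?_)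
  have htop : ⨆ i, (V i).comap N.incl = ⊤ := by
    apply hinj
    rw [LieSubmodule.map_iSup]
    simp_rw [hmap]
    rw [hV.iSup_eq, LieSubmodule.map_incl_top]
  rw [← htop]
  exact iSup_le fun i ↦ le_sSup (hatom i)

end Modules

/-! ### Root spaces, and submodules over subalgebras containing the Cartan subalgebra -/

variable {L : Type*} [LieRing L] [LieAlgebra ℂ L] [FiniteDimensional ℂ L] [IsKilling ℂ L]
  {H : LieSubalgebra ℂ L} [H.IsCartanSubalgebra]

lemma rootSpace_le_of_mem {W : Submodule ℂ L} {φ : H.root} {z : L}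
    (hz : z ∈ rootSpace H φ.1) (hz0 : z ≠ 0) (hW : z ∈ W) :
    (rootSpace H φ.1).toSubmodule ≤ W := by
  intro y hy
  obtain ⟨c, hc⟩ := (finrank_eq_one_iff_of_nonzero' (⟨z, hz⟩ : rootSpace H φ.1) (by simpa)).mp
    (finrank_rootSpace_eq_one φ.1 (H.isNonZero_coe_root φ)) ⟨y, hy⟩
  have : c • z = y := congrArg Subtype.val hc
  exact this ▸ W.smul_mem c hW

omit [IsKilling ℂ L] in
lemma exists_mem_rootSpace_ne_zero (φ : H.root) : ∃ z ∈ rootSpace H φ.1, z ≠ 0 :=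
  φ.1.exists_ne_zero

omit [FiniteDimensional ℂ L] [IsKilling ℂ L] in
lemma mem_rootSpace_of_forall_lie {χ : LieModule.Weight ℂ H L} {z : L}
    (h : ∀ x : H, ⁅x, z⁆ = χ x • z) : z ∈ rootSpace H χ :=
  LieModule.weightSpace_le_genWeightSpace L χ ((LieModule.mem_weightSpace χ z).mpr h)

/-- The bracket of two root spaces whose roots sum to a root is nonzero. -/
lemma exists_lie_ne_zero {α β γ : H.root}
    (h : (rootSystem H).root γ = (rootSystem H).root α + (rootSystem H).root β) :
    ∃ x ∈ rootSpace H α.1, ∃ y ∈ rootSpace H β.1, ⁅x, y⁆ ≠ 0 := by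
  have hα := H.isNonZero_coe_root α
  have hcoe : (γ.1 : H → ℂ) = α.1 + β.1 := by
    funext x
    exact LinearMap.congr_fun h x
  obtain ⟨x, hx, hx0⟩ := (LieModule.chainTop (α.1 : H → ℂ) β.1).exists_ne_zero
  obtain ⟨h', e, f, isSl2, he, hf⟩ := exists_isSl2Triple_of_weight_isNonZero hα
  obtain rfl := isSl2.h_eq_coroot hα he hf
  have prim : isSl2.HasPrimitiveVectorWith x (chainLength α.1 β.1 : ℂ) :=
    have := LieAlgebra.lie_mem_genWeightSpace_of_mem_genWeightSpace he hx
    ⟨hx0, (chainLength_smul _ _ hx).symm, by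
      rwa [LieModule.genWeightSpace_add_chainTop _ _ hα] at this⟩
  have htop : 1 ≤ LieModule.chainTopCoeff (α.1 : H → ℂ) β.1 := by
    have := (rootSpace_zsmul_add_ne_bot_iff α.1 β.1 hα 1).mp (by
      rw [one_smul, ← hcoe]; exact γ.1.genWeightSpace_ne_bot)
    lia
  obtain ⟨r, hr⟩ := Nat.exists_eq_add_of_le' htop
  have hle : LieModule.chainTopCoeff (α.1 : H → ℂ) β.1 ≤ chainLength α.1 β.1 := by
    rw [← chainTopCoeff_add_chainBotCoeff]; exact Nat.le_add_right _ _
  -- The vector `x` tops the α-string through β, which lies r + 1 steps lower. By sl₂ theory e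
  -- f^{r+1} x is (r + 1)(chain length - r) f^r x, with both factors and the vector nonzero.
  refine ⟨e, he, ((LieModule.toEnd ℂ L L f) ^ (r + 1)) x, ?_, ?_⟩
  · have := toEnd_pow_apply_mem hf hx (r + 1)
    convert this using 2
    rw [LieModule.coe_chainTop, hr]
    funext z
    simp
  · rw [prim.lie_e_pow_succ_toEnd_f]
    refine smul_ne_zero (mul_ne_zero (by exact_mod_cast Nat.succ_ne_zero r) ?_) ?_
    · rw [sub_ne_zero]
      exact_mod_cast (by lia : chainLength α.1 β.1 ≠ r)
    · exact prim.pow_toEnd_f_ne_zero_of_eq_nat rfl (by lia)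

/-- The roots whose root spaces are contained in a subspace `W`. -/
def rootSupport (H : LieSubalgebra ℂ L) [H.IsCartanSubalgebra] (W : Submodule ℂ L) :
    Set H.root :=
  {φ | (rootSpace H φ.1).toSubmodule ≤ W}

omit [IsKilling ℂ L] in
lemma rootSupport_mono {W W' : Submodule ℂ L} (h : W ≤ W') : rootSupport H W ⊆ rootSupport H W' :=
  fun _ hφ ↦ hφ.trans h

lemma mem_rootSupport_of_mem {W : Submodule ℂ L} {φ : H.root} {z : L}
    (hz : z ∈ rootSpace H φ.1) (hz0 : z ≠ 0) (hW : z ∈ W) : φ ∈ rootSupport H W :=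
  rootSpace_le_of_mem hz hz0 hW

section Subalgebra

variable {K : LieSubalgebra ℂ L} (hK : H ≤ K)
include hK

/-- A submodule of `𝔤` over a subalgebra containing the Cartan subalgebra is spanned by its
intersection with the Cartan subalgebra and the root spaces which it contains. -/
lemma le_of_rootSupport_subset (N : LieSubmodule ℂ K L) {W : Submodule ℂ L}
    (h₀ : ∀ z ∈ N, z ∈ H → z ∈ W) (h : rootSupport H N.toSubmodule ⊆ rootSupport H W) :
    N.toSubmodule ≤ W := by
  have hN : (restrictTo hK N).toSubmodule ≤ W := by
    -- Being stable under `H`, the submodule is the sum of its intersections with the weight spaces.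
    rw [LieModule.eq_iSup_inf_genWeightSpace (N := restrictTo hK N), LieSubmodule.iSup_toSubmodule]
    refine iSup_le fun χ z hz ↦ ?_
    obtain ⟨hzN, hzχ⟩ : z ∈ N ∧ z ∈ LieModule.genWeightSpace L χ := hz
    by_cases hz0 : z = 0
    · rw [hz0]; exact W.zero_mem
    by_cases hχ : χ.IsZero
    · refine h₀ z hzN ?_
      rw [hχ.eq] at hzχ
      have : z ∈ rootSpace H (0 : H → ℂ) := hzχ
      rwa [rootSpace_zero_eq] at this
    · let φ : H.root := ⟨χ, by simpa [LieSubalgebra.root] using hχ⟩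
      exact h (mem_rootSupport_of_mem (φ := φ) hzχ hz0 hzN) hzχ
  exact hN

lemma rootSupport_nonempty {N : LieSubmodule ℂ K L} (h₀ : ∀ z ∈ N, z ∈ H → z = 0) (hN : N ≠ ⊥) :
    (rootSupport H N.toSubmodule).Nonempty := by
  by_contra h
  rw [Set.not_nonempty_iff_eq_empty] at h
  refine hN ?_
  rw [← LieSubmodule.toSubmodule_eq_bot, eq_bot_iff]
  exact le_of_rootSupport_subset hK N (fun z hz hzH ↦ h₀ z hz hzH)
    (by rw [h]; exact Set.empty_subset _)

-- The bracket of two root spaces is nonzero when the sum is a root, and a nonzero vector fills its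
-- root space. Closure of `S` under negation reduces subtraction to addition.
omit hK in
lemma isStableUnder_rootSupport (N : LieSubmodule ℂ K L) {S : Set H.root}
    (hS : S ⊆ rootSupport H K.toSubmodule)
    (hS' : ∀ s ∈ S, ∀ k, (rootSystem H).root k = -(rootSystem H).root s → k ∈ S) :
    (rootSystem H).IsStableUnder (rootSupport H N.toSubmodule) S := by
  have key : ∀ a ∈ rootSupport H N.toSubmodule, ∀ s ∈ S, ∀ k,
      (rootSystem H).root k = (rootSystem H).root a + (rootSystem H).root s →
      k ∈ rootSupport H N.toSubmodule := by
    intro a ha s hs k hk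
    obtain ⟨x, hx, y, hy, hxy⟩ := exists_lie_ne_zero (α := s) (β := a) (γ := k)
      (by rw [hk, add_comm])
    refine mem_rootSupport_of_mem (z := ⁅x, y⁆) ?_ hxy ?_
    · have := LieAlgebra.lie_mem_genWeightSpace_of_mem_genWeightSpace hx hy
      convert this using 2
      funext z
      rw [add_comm]
      exact LinearMap.congr_fun hk z
    · exact N.lie_mem (x := ⟨x, hS hs hx⟩) (ha hy)
  rintro a ha s hs k (hk | hk)
  · exact key a ha s hs k hk
  · obtain ⟨s', hs'⟩ := (rootSystem H).exists_root_eq_neg s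
    exact key a ha s' (hS' s hs s' hs') k (by rw [hk, hs', sub_eq_add_neg])

/-- An isomorphism commutes with `H`, so it sends a root vector to a nonzero vector of the same
weight, which spans the same line. Isomorphic submodules therefore contain the same root spaces. -/
lemma isMultiplicityFree_of_isIrreducibleDecomposition {ι : Type*} {N : LieSubmodule ℂ K L}
    (h₀ : ∀ z ∈ N, z ∈ H → z = 0)
    {V : ι → LieSubmodule ℂ K L} (hV : IsIrreducibleDecomposition N V) :
    IsMultiplicityFree K N := by
  refine ⟨complementedLattice_of_isIrreducibleDecomposition hV, fun A B _ _ ⟨e⟩ ↦ ?_⟩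
  have key (A B : LieSubmodule ℂ K N) (e : A ≃ₗ⁅ℂ, K⁆ B) : A ≤ B := by
    have h1 : (A.map N.incl).toSubmodule ≤ (B.map N.incl).toSubmodule := by
      refine le_of_rootSupport_subset hK _ (fun z hz hzH ↦ ?_) fun φ hφ ↦ ?_
      · rw [h₀ z (LieSubmodule.map_incl_le hz) hzH]; exact zero_mem _
      · obtain ⟨z, hz, hz0⟩ := exists_mem_rootSpace_ne_zero φ
        obtain ⟨y, hy, rfl⟩ := hφ hz
        refine mem_rootSupport_of_mem (z := ((e ⟨y, hy⟩ : N) : L)) ?_ ?_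
          ⟨e ⟨y, hy⟩, (e ⟨y, hy⟩).2, rfl⟩
        · refine mem_rootSpace_of_forall_lie fun x ↦ ?_
          have h2 : ⁅(⟨x, hK x.2⟩ : K), (⟨y, hy⟩ : A)⁆ = φ.1 x • (⟨y, hy⟩ : A) := by
            apply Subtype.ext
            apply Subtype.ext
            exact lie_eq_smul_of_mem_rootSpace hz x
          have h3 := congrArg e h2
          rw [map_smul, show e ⁅(⟨x, hK x.2⟩ : K), (⟨y, hy⟩ : A)⁆ =
            ⁅(⟨x, hK x.2⟩ : K), e ⟨y, hy⟩⁆ from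
            e.toLieModuleHom.map_lie _ _] at h3
          exact congrArg (fun w : B ↦ ((w : N) : L)) h3
        · intro h
          have h2 : e ⟨y, hy⟩ = 0 := Subtype.ext (Subtype.ext h)
          have h3 := (map_eq_zero_iff e e.injective).mp h2
          apply hz0
          have := congrArg (fun w : A ↦ ((w : N) : L)) h3
          exact this
    exact fun z hz ↦ coe_mem_map_incl_iff.mp (h1 (coe_mem_map_incl_iff.mpr hz))
  exact le_antisymm (key A B e) (key B A e.symm)

/-- A subalgebra containing the Cartan subalgebra, whose roots are closed under negation and
separate the points of the Cartan subalgebra, has trivial radical. -/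
lemma hasTrivialRadical_of_rootSupport
    (hneg : ∀ φ ∈ rootSupport H K.toSubmodule, ∀ χ,
      (rootSystem H).root χ = -(rootSystem H).root φ → χ ∈ rootSupport H K.toSubmodule)
    (hsep : ∀ x : H, (∀ φ ∈ rootSupport H K.toSubmodule, (rootSystem H).root φ x = 0) → x = 0) :
    HasTrivialRadical ℂ K := by
  rw [hasTrivialRadical_iff_no_abelian_ideals]
  intro I hI
  let N : LieSubmodule ℂ K L :=
    { I.toSubmodule.map K.subtype with
      lie_mem := by
        rintro x _ ⟨y, hy, rfl⟩
        exact ⟨⁅x, y⁆, lie_mem_right ℂ K I x y hy, rfl⟩ }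
  have hNK (z : L) (hz : z ∈ N) : z ∈ K := by
    obtain ⟨y, _, rfl⟩ := hz; exact y.2
  have hab (y z : L) (hy : y ∈ N) (hz : z ∈ N) : ⁅y, z⁆ = 0 := by
    obtain ⟨y, hy, rfl⟩ := hy
    obtain ⟨z, hz, rfl⟩ := hz
    have := congrArg Subtype.val (hI.trivial ⟨y, hy⟩ ⟨z, hz⟩)
    exact congrArg Subtype.val this
  -- If 𝔤_φ lay in the abelian ideal, so would h = [e, f], yet [h, e] = 2e ≠ 0.
  have hno (φ : H.root) : φ ∉ rootSupport H N.toSubmodule := by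
    intro hφ
    obtain ⟨χ, hχ⟩ := (rootSystem H).exists_root_eq_neg φ
    obtain ⟨h, e, f, ht, he, hf⟩ :=
      exists_isSl2Triple_of_weight_isNonZero (H.isNonZero_coe_root φ)
    have hχ' : (χ.1 : H → ℂ) = -φ.1 := funext fun x ↦ LinearMap.congr_fun hχ x
    have hfK : f ∈ K :=
      hneg φ (fun z hz ↦ hNK z (hφ hz)) χ hχ (by rw [hχ']; exact hf)
    have hN : h ∈ N := by
      rw [← ht.lie_e_f, ← lie_skew]
      exact neg_mem (N.lie_mem (x := ⟨f, hfK⟩) (hφ he))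
    have h1 := ht.lie_h_e_nsmul
    rw [hab h e hN (hφ he), eq_comm, ← Nat.cast_smul_eq_nsmul ℂ, smul_eq_zero] at h1
    exact ht.e_ne_zero (h1.resolve_left (by norm_num))
  have hN : N.toSubmodule ≤ ⊥ := by
    refine le_of_rootSupport_subset hK N (fun z hz hzH ↦ ?_) fun φ hφ ↦ absurd hφ (hno φ)
    -- For z in `H` with φ(z) ≠ 0, the relation [z, y] = φ(z) y would put 𝔤_φ into the ideal.
    have := hsep ⟨z, hzH⟩ fun φ hφ ↦ by
      by_contra h0
      obtain ⟨y, hy, hy0⟩ := exists_mem_rootSpace_ne_zero φ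
      refine hno φ (mem_rootSupport_of_mem hy hy0 ?_)
      have h1 : ⁅z, y⁆ ∈ N := by
        rw [← lie_skew]
        exact neg_mem (N.lie_mem (x := ⟨y, hφ hy⟩) hz)
      have h2 : ⁅z, y⁆ = φ.1 ⟨z, hzH⟩ • y := lie_eq_smul_of_mem_rootSpace hy ⟨z, hzH⟩
      rw [h2] at h1
      exact (N.toSubmodule.smul_mem_iff h0).mp h1
    exact congrArg Subtype.val this
  rw [eq_bot_iff]
  intro y hy
  have : (y : L) = 0 := hN ⟨y, hy, rfl⟩
  exact Subtype.ext this

end Subalgebra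

end SpecialElement

namespace SpecialElement

/-! ### Eigenspaces and their roots -/

section Eigenspaces

variable {L : Type*} [LieRing L] [LieAlgebra ℂ L]

lemma iSupIndep_adEigenModule (x : L) : iSupIndep (adEigenModule x) := by
  rw [← LieSubmodule.iSupIndep_toSubmodule]
  convert (ad ℂ L x).eigenspaces_iSupIndep using 2 with c
  ext z
  rw [End.mem_eigenspace_iff]
  rfl

lemma iSupIndep_eigenModule (a : L ≃ₗ⁅ℂ⁆ L) : iSupIndep (eigenModule a) := by
  rw [← LieSubmodule.iSupIndep_toSubmodule]
  convert (Module.End.eigenspaces_iSupIndep (a : L →ₗ[ℂ] L)) using 2 with c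
  ext z
  rw [End.mem_eigenspace_iff]
  rfl

end Eigenspaces

section Torus

variable {L : Type*} [LieRing L] [LieAlgebra ℂ L] [FiniteDimensional ℂ L] [IsKilling ℂ L]
  {H : LieSubalgebra ℂ L} [H.IsCartanSubalgebra] (b : (rootSystem H).Base) (ψ : H.root)
  (j : b.support)

lemma simpleCoeff_eq_rootCoeff (φ : H.root) (j : b.support) :
    b.simpleCoeff φ j = rootCoeff b φ j := rfl

lemma root_apply_fundCoweight (φ : H.root) :
    (rootSystem H).root φ (fundCoweight b j) = rootCoeff b φ j := by
  rw [root_eq_sum_rootCoeff b φ, LinearMap.sum_apply, Finset.sum_eq_single j]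
  · rw [LinearMap.smul_apply, root_fundCoweight_self, zsmul_eq_mul, mul_one]
  · intro i _ hi
    rw [LinearMap.smul_apply, root_fundCoweight_of_ne b i j hi, smul_zero]
  · simp

lemma lie_fundCoweight_of_mem_rootSpace {φ : H.root} {z : L} (hz : z ∈ rootSpace H φ.1) :
    ⁅(fundCoweight b j : L), z⁆ = (rootCoeff b φ j : ℂ) • z := by
  rw [← root_apply_fundCoweight]
  exact lie_eq_smul_of_mem_rootSpace hz (fundCoweight b j)

lemma lie_fundCoweight_of_mem {z : L} (hz : z ∈ H) : ⁅(fundCoweight b j : L), z⁆ = 0 :=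
  congrArg Subtype.val (trivial_lie_zero H H (fundCoweight b j) ⟨z, hz⟩)

lemma adVertex_apply_of_mem_rootSpace {φ : H.root} {z : L} (hz : z ∈ rootSpace H φ.1) :
    adVertex b ψ j z = omega b ψ j ^ rootCoeff b φ j • z := by
  have h : ad ℂ L (((2 * Real.pi * Complex.I) • alcoveVertex b ψ j : H) : L) z =
      (rootCoeff b φ j * (2 * Real.pi * Complex.I / (rootCoeff b ψ j : ℂ))) • z := by
    change ⁅(2 * Real.pi * Complex.I : ℂ) • (rootCoeff b ψ j : ℂ)⁻¹ • (fundCoweight b j : L), z⁆ = _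
    rw [smul_lie, smul_lie, lie_fundCoweight_of_mem_rootSpace b j hz, smul_smul, smul_smul]
    congr 1
    ring
  rw [adVertex, adExp_apply, expEnd_apply_of_eigenvector _ _ _ h, omega, Complex.exp_int_mul]

lemma cartan_le_levi : H ≤ levi b j := fun _ hz ↦ lie_fundCoweight_of_mem b j hz

lemma cartan_le_fixedSubalgebra : H ≤ fixedSubalgebra (adVertex b ψ j) :=
  (cartan_le_levi b j).trans (levi_le_fixedSubalgebra b ψ j)

lemma mem_rootSupport_gradedPiece {φ : H.root} {k : ℤ} :
    φ ∈ rootSupport H (gradedPiece b j k).toSubmodule ↔ rootCoeff b φ j = k := by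
  constructor
  · intro h
    obtain ⟨z, hz, hz0⟩ := exists_mem_rootSpace_ne_zero φ
    have h1 : ⁅(fundCoweight b j : L), z⁆ = (k : ℂ) • z := h hz
    rw [lie_fundCoweight_of_mem_rootSpace b j hz] at h1
    exact_mod_cast smul_left_injective ℂ hz0 h1
  · rintro rfl z hz
    exact lie_fundCoweight_of_mem_rootSpace b j hz

lemma mem_rootSupport_levi {φ : H.root} :
    φ ∈ rootSupport H (levi b j).toSubmodule ↔ rootCoeff b φ j = 0 := by
  rw [← mem_rootSupport_gradedPiece]
  have : (levi b j).toSubmodule = (gradedPiece b j 0).toSubmodule := by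
    ext z
    change ⁅(fundCoweight b j : L), z⁆ = 0 ↔ ⁅(fundCoweight b j : L), z⁆ = ((0 : ℤ) : ℂ) • z
    simp
  rw [this]

lemma eq_zero_of_mem_gradedPiece {k : ℤ} (hk : k ≠ 0) {z : L} (hz : z ∈ gradedPiece b j k)
    (hzH : z ∈ H) : z = 0 := by
  have h1 : ⁅(fundCoweight b j : L), z⁆ = (k : ℂ) • z := hz
  rw [lie_fundCoweight_of_mem b j hzH, eq_comm, smul_eq_zero] at h1
  exact h1.resolve_left (by exact_mod_cast hk)

/-- The space `𝔤_{kβ[j]}` is an irreducible module over the Levi factor if it is nonzero. -/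
theorem isIrreducible_gradedPiece {k : ℤ} (hk : k ≠ 0) (hk' : ∃ φ, rootCoeff b φ j = k) :
    LieModule.IsIrreducible ℂ (levi b j) (gradedPiece b j k) := by
  refine isIrreducible_of_forall_le ?_ fun N hN hN0 ↦ ?_
  · obtain ⟨φ, hφ⟩ := hk'
    obtain ⟨z, hz, hz0⟩ := exists_mem_rootSpace_ne_zero φ
    exact fun h ↦ hz0 ((LieSubmodule.eq_bot_iff _).mp h z
      ((mem_rootSupport_gradedPiece b j).mpr hφ hz))
  · refine le_of_rootSupport_subset (cartan_le_levi b j) (gradedPiece b j k)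
      (fun z hz hzH ↦ ?_) fun φ hφ ↦ ?_
    · rw [eq_zero_of_mem_gradedPiece b j hk hz hzH]; exact zero_mem _
    · rw [mem_rootSupport_gradedPiece] at hφ
      refine b.mem_of_isStableUnder_level j hk (rootSupport_nonempty (cartan_le_levi b j)
        (fun z hz ↦ eq_zero_of_mem_gradedPiece b j hk (hN hz)) hN0)
        (isStableUnder_rootSupport N ?_ ?_) ?_ hφ
      · exact fun s hs ↦ (mem_rootSupport_levi b j).mpr hs
      · intro s hs l hl
        have h := b.simpleCoeff_of_neg hl j
        rwa [show b.simpleCoeff s j = 0 from hs, neg_zero] at h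
      · exact fun a ha ↦ (mem_rootSupport_gradedPiece b j).mp (rootSupport_mono hN ha)

variable (hn : 0 < rootCoeff b ψ j)
include hn

lemma omega_zpow_eq_iff (k l : ℤ) :
    omega b ψ j ^ k = omega b ψ j ^ l ↔ rootCoeff b ψ j ∣ k - l := by
  obtain ⟨n, hn'⟩ := Int.eq_ofNat_of_zero_le hn.le
  have h0 : omega b ψ j ≠ 0 := Complex.exp_ne_zero _
  have hprim : IsPrimitiveRoot (omega b ψ j) n := by
    rw [omega, hn', Int.cast_natCast]
    exact Complex.isPrimitiveRoot_exp n (by lia)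
  rw [hn', ← hprim.zpow_eq_one_iff_dvd, zpow_sub₀ h0, div_eq_one_iff_eq (zpow_ne_zero _ h0)]

lemma mem_rootSupport_adVertexEigen {φ : H.root} {k : ℤ} :
    φ ∈ rootSupport H (adVertexEigen b ψ j k).toSubmodule ↔
      rootCoeff b ψ j ∣ rootCoeff b φ j - k := by
  rw [← omega_zpow_eq_iff b ψ j hn]
  constructor
  · intro h
    obtain ⟨z, hz, hz0⟩ := exists_mem_rootSpace_ne_zero φ
    have h1 : adVertex b ψ j z = omega b ψ j ^ k • z := h hz
    rw [adVertex_apply_of_mem_rootSpace b ψ j hz] at h1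
    exact smul_left_injective ℂ hz0 h1
  · intro h z hz
    change adVertex b ψ j z = omega b ψ j ^ k • z
    rw [adVertex_apply_of_mem_rootSpace b ψ j hz, h]

lemma mem_rootSupport_fixedSubalgebra {φ : H.root} :
    φ ∈ rootSupport H (fixedSubalgebra (adVertex b ψ j)).toSubmodule ↔
      rootCoeff b ψ j ∣ rootCoeff b φ j := by
  rw [← sub_zero (rootCoeff b φ j), ← mem_rootSupport_adVertexEigen b ψ j hn]
  have : (fixedSubalgebra (adVertex b ψ j)).toSubmodule =
      (adVertexEigen b ψ j 0).toSubmodule := by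
    ext z
    change adVertex b ψ j z = z ↔ adVertex b ψ j z = omega b ψ j ^ (0 : ℤ) • z
    simp
  rw [this]

lemma eq_zero_of_mem_adVertexEigen {k : ℤ} (hk : ¬ rootCoeff b ψ j ∣ k) {z : L}
    (hz : z ∈ adVertexEigen b ψ j k) (hzH : z ∈ H) : z = 0 := by
  have h1 : adVertex b ψ j z = omega b ψ j ^ k • z := hz
  have h2 : adVertex b ψ j z = z := cartan_le_fixedSubalgebra b ψ j hzH
  rw [h2] at h1
  by_contra h0
  have h3 : omega b ψ j ^ k = omega b ψ j ^ (0 : ℤ) := by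
    rw [zpow_zero]
    exact smul_left_injective ℂ h0 (by simpa using h1.symm)
  rw [omega_zpow_eq_iff b ψ j hn, sub_zero] at h3
  exact hk h3

/-- Ad a_j preserves the Killing form, fixes `y`, and scales `z` by a power of ω different from 1.
-/
lemma killingForm_eq_zero_of_mem_rootSpace {φ : H.root} (hφ : ¬ rootCoeff b ψ j ∣ rootCoeff b φ j)
    {y z : L} (hy : y ∈ fixedSubalgebra (adVertex b ψ j)) (hz : z ∈ rootSpace H φ.1) :
    killingForm ℂ L y z = 0 := by
  have h1 := LieAlgebra.killingForm_of_equiv_apply (adVertex b ψ j) y z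
  have h2 : adVertex b ψ j y = y := hy
  rw [h2, adVertex_apply_of_mem_rootSpace b ψ j hz, map_smul, smul_eq_mul] at h1
  by_contra h0
  have h3 : omega b ψ j ^ rootCoeff b φ j = omega b ψ j ^ (0 : ℤ) := by
    rw [zpow_zero]
    exact mul_right_cancel₀ h0 (by rw [h1, one_mul])
  rw [omega_zpow_eq_iff b ψ j hn, sub_zero] at h3
  exact hφ h3

omit hn in
lemma eq_zero_of_mem_vertexOrtho {z : L} (hz : z ∈ vertexOrtho b ψ j) (hzH : z ∈ H) : z = 0 := by
  have h0 : z ∈ rootSpace H (0 : H → ℂ) := by rwa [rootSpace_zero_eq]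
  have h1 := mem_ker_killingForm_of_mem_rootSpace_of_forall_rootSpace_neg ℂ L H h0 fun y hy ↦ by
    rw [neg_zero, rootSpace_zero_eq] at hy
    rw [LieModule.traceForm_comm]
    exact hz y (cartan_le_fixedSubalgebra b ψ j hy)
  rwa [IsKilling.ker_killingForm_eq_bot, Submodule.mem_bot] at h1

lemma mem_rootSupport_vertexOrtho {φ : H.root} :
    φ ∈ rootSupport H (vertexOrtho b ψ j).toSubmodule ↔
      ¬ rootCoeff b ψ j ∣ rootCoeff b φ j := by
  constructor
  · intro h hdvd
    obtain ⟨z, hz, hz0⟩ := exists_mem_rootSpace_ne_zero φ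
    obtain ⟨χ, hχ⟩ := (rootSystem H).exists_root_eq_neg φ
    have hχ' : (χ.1 : H → ℂ) = -φ.1 := funext fun x ↦ LinearMap.congr_fun hχ x
    -- The form pairs 𝔤_φ with 𝔤_{-φ}, which also lies in 𝔤^{a_j}; a root vector orthogonal to it
    -- would be in the kernel of the form.
    have h1 := mem_ker_killingForm_of_mem_rootSpace_of_forall_rootSpace_neg ℂ L H hz fun y hy ↦ by
      rw [LieModule.traceForm_comm]
      refine h hz y ?_
      refine (mem_rootSupport_fixedSubalgebra b ψ j hn (φ := χ)).mpr ?_ (by rw [hχ']; exact hy)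
      have := b.simpleCoeff_of_neg hχ j
      rw [simpleCoeff_eq_rootCoeff, simpleCoeff_eq_rootCoeff] at this
      rw [this]
      exact (dvd_neg).mpr hdvd
    rw [IsKilling.ker_killingForm_eq_bot, Submodule.mem_bot] at h1
    exact hz0 h1
  · exact fun h z hz y hy ↦ killingForm_eq_zero_of_mem_rootSpace b ψ j hn h hy hz

end Torus

end SpecialElement

lemma Int.not_dvd_of_one_le_of_le {n k : ℤ} (hk : 1 ≤ k) (hk' : k ≤ n - 1) : ¬ n ∣ k :=
  fun h ↦ by have := Int.le_of_dvd (by lia) h; lia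

lemma Int.not_dvd_of_one_le_abs_of_le {n k : ℤ} (hk : 1 ≤ |k|) (hk' : |k| ≤ n - 1) : ¬ n ∣ k := by
  rw [← dvd_abs]
  exact Int.not_dvd_of_one_le_of_le hk hk'

/-! ### Irreducible decompositions for a simple Lie algebra -/

namespace SpecialElement

variable {L : Type*} [LieRing L] [LieAlgebra ℂ L] [FiniteDimensional ℂ L] [IsSimple ℂ L]
  {H : LieSubalgebra ℂ L} [H.IsCartanSubalgebra] {b : (rootSystem H).Base} {ψ : H.root}

omit [IsSimple ℂ L] in
lemma eq_zero_of_forall_simpleRoot_eq_zero [IsKilling ℂ L] (b : (rootSystem H).Base) {x : H}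
    (h : ∀ i : b.support, (rootSystem H).root i x = 0) : x = 0 := by
  refine (forall_dual_apply_eq_zero_iff ℂ x).mp fun f ↦ ?_
  rw [← b.toWeightBasis.sum_repr f, LinearMap.sum_apply]
  refine Finset.sum_eq_zero fun i _ ↦ ?_
  rw [LinearMap.smul_apply, RootPairing.Base.toWeightBasis_apply, h, smul_zero]

lemma exists_rootCoeff_eq (b : (rootSystem H).Base) (ψ : H.root) (j : b.support) {k : ℤ}
    (hk : k ≠ 0) (hk' : |k| ≤ rootCoeff b ψ j) : ∃ φ, rootCoeff b φ j = k :=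
  b.exists_simpleCoeff_eq hk hk'

namespace IsHighestRoot

variable (hψ : IsHighestRoot b ψ) (j : b.support)
include hψ

lemma isMaximalRoot : b.IsMaximalRoot ψ := hψ

lemma rootCoeff_pos : 0 < rootCoeff b ψ j := hψ.isMaximalRoot.simpleCoeff_pos j

lemma abs_rootCoeff_le (φ : H.root) : |rootCoeff b φ j| ≤ rootCoeff b ψ j :=
  hψ.isMaximalRoot.abs_simpleCoeff_le φ j

/-- As |n_j(φ)| ≤ n and 1 ≤ k ≤ n - 1, the quotient (n_j(φ) - k)/n can only be 0 or -1. -/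
lemma dvd_rootCoeff_sub_iff {k : ℤ} (hk : 1 ≤ k) (hk' : k ≤ rootCoeff b ψ j - 1) (φ : H.root) :
    rootCoeff b ψ j ∣ rootCoeff b φ j - k ↔
      rootCoeff b φ j = k ∨ rootCoeff b φ j = k - rootCoeff b ψ j := by
  have h := abs_le.mp (hψ.abs_rootCoeff_le j φ)
  constructor
  · rintro ⟨c, hc⟩
    have h1 : c < 1 := by nlinarith
    have h2 : -2 < c := by nlinarith
    obtain rfl | rfl : c = 0 ∨ c = -1 := by lia
    · left; lia
    · right; lia
  · rintro (h | h)
    · rw [h, sub_self]; exact dvd_zero _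
    · rw [h]; exact ⟨-1, by ring⟩

/-- The eigenspaces of `Ad a_j` for the eigenvalues other than `1` are irreducible modules over
the fixed subalgebra. -/
theorem isIrreducible_adVertexEigen {k : ℤ} (hk : 1 ≤ k) (hk' : k ≤ rootCoeff b ψ j - 1) :
    LieModule.IsIrreducible ℂ (fixedSubalgebra (adVertex b ψ j)) (adVertexEigen b ψ j k) := by
  have hn := hψ.rootCoeff_pos j
  have hnd := Int.not_dvd_of_one_le_of_le hk hk'
  have hH := cartan_le_fixedSubalgebra b ψ j
  have h0 (z : L) (hz : z ∈ adVertexEigen b ψ j k) (hzH : z ∈ H) : z = 0 :=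
    eq_zero_of_mem_adVertexEigen b ψ j hn hnd hz hzH
  refine isIrreducible_of_forall_le ?_ fun N hN hN0 ↦ ?_
  · obtain ⟨φ, hφ⟩ := exists_rootCoeff_eq b ψ j (k := k) (by lia) (abs_le.mpr ⟨by lia, by lia⟩)
    obtain ⟨z, hz, hz0⟩ := exists_mem_rootSpace_ne_zero φ
    exact fun h ↦ hz0 ((LieSubmodule.eq_bot_iff _).mp h z
      ((mem_rootSupport_adVertexEigen b ψ j hn).mpr (by rw [hφ, sub_self]; exact dvd_zero _) hz))
  · refine le_of_rootSupport_subset hH _ (fun z hz hzH ↦ ?_) fun φ hφ ↦ ?_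
    · rw [h0 z hz hzH]; exact zero_mem _
    · rw [mem_rootSupport_adVertexEigen b ψ j hn, hψ.dvd_rootCoeff_sub_iff j hk hk'] at hφ
      refine b.mem_of_isStableUnder_residue j ⟨ψ, rfl⟩ hk hk' (rootSupport_nonempty hH
        (fun z hz ↦ h0 z (hN hz)) hN0) (isStableUnder_rootSupport N ?_ ?_) ?_ hφ
      · exact fun s hs ↦ (mem_rootSupport_fixedSubalgebra b ψ j hn).mpr hs
      · intro s hs l hl
        change _ ∣ b.simpleCoeff l j
        rw [b.simpleCoeff_of_neg hl j, dvd_neg]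
        exact hs
      · intro a ha
        have := (mem_rootSupport_adVertexEigen b ψ j hn).mp (rootSupport_mono hN ha)
        exact (hψ.dvd_rootCoeff_sub_iff j hk hk' a).mp this

theorem isIrreducibleDecomposition_vertexOrtho :
    IsIrreducibleDecomposition (vertexOrtho b ψ j)
      (fun k : {k : ℤ // 1 ≤ k ∧ k ≤ rootCoeff b ψ j - 1} ↦ adVertexEigen b ψ j k) where
  irreducible k := hψ.isIrreducible_adVertexEigen j k.2.1 k.2.2
  independent := by
    refine (iSupIndep_eigenModule (adVertex b ψ j)).comp
      (f := fun k : {k : ℤ // 1 ≤ k ∧ k ≤ rootCoeff b ψ j - 1} ↦ omega b ψ j ^ (k : ℤ)) ?_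
    intro k l h
    rw [omega_zpow_eq_iff b ψ j (hψ.rootCoeff_pos j)] at h
    refine Subtype.ext (Int.eq_of_sub_eq_zero (Int.eq_zero_of_abs_lt_dvd h ?_))
    have hk := k.2
    have hl := l.2
    rw [abs_lt]
    constructor <;> lia
  iSup_eq := by
    have hn := hψ.rootCoeff_pos j
    have hH := cartan_le_fixedSubalgebra b ψ j
    refine le_antisymm (iSup_le fun k ↦ ?_) ?_
    · refine le_of_rootSupport_subset hH _ (fun z hz hzH ↦ ?_) fun φ hφ ↦ ?_
      · rw [eq_zero_of_mem_adVertexEigen b ψ j hn (Int.not_dvd_of_one_le_of_le k.2.1 k.2.2) hz hzH]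
        exact zero_mem _
      · rw [mem_rootSupport_adVertexEigen b ψ j hn] at hφ
        rw [mem_rootSupport_vertexOrtho b ψ j hn]
        exact fun h ↦ Int.not_dvd_of_one_le_of_le k.2.1 k.2.2 ((dvd_sub_right h).mp hφ)
    · refine le_of_rootSupport_subset hH _ (fun z hz hzH ↦ ?_) fun φ hφ ↦ ?_
      · rw [eq_zero_of_mem_vertexOrtho b ψ j hz hzH]
        exact zero_mem _
      · rw [mem_rootSupport_vertexOrtho b ψ j hn] at hφ
        have h1 := Int.emod_nonneg (rootCoeff b φ j) hn.ne'
        have h2 := Int.emod_lt_of_pos (rootCoeff b φ j) hn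
        have h3 : rootCoeff b φ j % rootCoeff b ψ j ≠ 0 :=
          fun h ↦ hφ (Int.dvd_of_emod_eq_zero h)
        let k : {k : ℤ // 1 ≤ k ∧ k ≤ rootCoeff b ψ j - 1} :=
          ⟨rootCoeff b φ j % rootCoeff b ψ j, by lia, by lia⟩
        refine rootSupport_mono (H := H) (LieSubmodule.toSubmodule_le_toSubmodule _ _ |>.mpr
          (le_iSup (fun k : {k : ℤ // 1 ≤ k ∧ k ≤ rootCoeff b ψ j - 1} ↦ adVertexEigen b ψ j k) k))
          ((mem_rootSupport_adVertexEigen b ψ j hn).mpr ?_)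
        exact Int.dvd_self_sub_emod

theorem isMultiplicityFree_vertexOrtho :
    IsMultiplicityFree (fixedSubalgebra (adVertex b ψ j)) (vertexOrtho b ψ j) :=
  isMultiplicityFree_of_isIrreducibleDecomposition (cartan_le_fixedSubalgebra b ψ j)
    (fun _ ↦ eq_zero_of_mem_vertexOrtho b ψ j) (hψ.isIrreducibleDecomposition_vertexOrtho j)

theorem isIrreducibleDecomposition_levi_vertexOrtho :
    IsIrreducibleDecomposition (restrictTo (levi_le_fixedSubalgebra b ψ j) (vertexOrtho b ψ j))
      (fun k : {k : ℤ // 1 ≤ |k| ∧ |k| ≤ rootCoeff b ψ j - 1} ↦ gradedPiece b j k) where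
  irreducible k := isIrreducible_gradedPiece b j (abs_pos.mp (by have := k.2.1; lia))
    (exists_rootCoeff_eq b ψ j (abs_pos.mp (by have := k.2.1; lia)) (by have := k.2.2; lia))
  independent := by
    refine (iSupIndep_adEigenModule (fundCoweight b j : L)).comp
      (f := fun k : {k : ℤ // 1 ≤ |k| ∧ |k| ≤ rootCoeff b ψ j - 1} ↦ ((k : ℤ) : ℂ)) ?_
    exact fun k l h ↦ Subtype.ext (Int.cast_injective (α := ℂ) h)
  iSup_eq := by
    have hn := hψ.rootCoeff_pos j
    have hH := cartan_le_levi b j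
    refine le_antisymm (iSup_le fun k ↦ ?_) ?_
    · refine le_of_rootSupport_subset hH _ (fun z hz hzH ↦ ?_) fun φ hφ ↦ ?_
      · rw [eq_zero_of_mem_gradedPiece b j (abs_pos.mp (by have := k.2.1; lia)) hz hzH]
        exact zero_mem _
      · rw [mem_rootSupport_gradedPiece b j] at hφ
        refine (mem_rootSupport_vertexOrtho b ψ j hn).mpr ?_
        rw [hφ]
        exact Int.not_dvd_of_one_le_abs_of_le k.2.1 k.2.2
    · refine le_of_rootSupport_subset hH _ (fun z hz hzH ↦ ?_) fun φ hφ ↦ ?_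
      · rw [eq_zero_of_mem_vertexOrtho b ψ j hz hzH]
        exact zero_mem _
      · replace hφ := (mem_rootSupport_vertexOrtho b ψ j hn).mp hφ
        have h1 := hψ.abs_rootCoeff_le j φ
        have h2 : |rootCoeff b φ j| ≠ rootCoeff b ψ j := fun h ↦ hφ (by rw [← h, abs_dvd])
        have h3 : rootCoeff b φ j ≠ 0 := fun h ↦ hφ (by rw [h]; exact dvd_zero _)
        have h4 := abs_pos.mpr h3
        let k : {k : ℤ // 1 ≤ |k| ∧ |k| ≤ rootCoeff b ψ j - 1} :=
          ⟨rootCoeff b φ j, by lia, by lia⟩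
        exact rootSupport_mono (H := H) (LieSubmodule.toSubmodule_le_toSubmodule _ _ |>.mpr
          (le_iSup (fun k : {k : ℤ // 1 ≤ |k| ∧ |k| ≤ rootCoeff b ψ j - 1} ↦ gradedPiece b j k) k))
          ((mem_rootSupport_gradedPiece b j).mpr rfl)

theorem isMultiplicityFree_levi_vertexOrtho :
    IsMultiplicityFree (levi b j)
      (restrictTo (levi_le_fixedSubalgebra b ψ j) (vertexOrtho b ψ j)) :=
  isMultiplicityFree_of_isIrreducibleDecomposition (cartan_le_levi b j)
    (fun _ ↦ eq_zero_of_mem_vertexOrtho b ψ j) (hψ.isIrreducibleDecomposition_levi_vertexOrtho j)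

theorem isIrreducibleDecomposition_levi_adVertexEigen {k : ℤ} (hk : 1 ≤ k)
    (hk' : k ≤ rootCoeff b ψ j - 1) :
    IsIrreducibleDecomposition (restrictTo (levi_le_fixedSubalgebra b ψ j) (adVertexEigen b ψ j k))
      ![gradedPiece b j k, gradedPiece b j (k - rootCoeff b ψ j)] where
  irreducible i := by
    fin_cases i
    · exact isIrreducible_gradedPiece b j (by lia)
        (exists_rootCoeff_eq b ψ j (by lia) (abs_le.mpr ⟨by lia, by lia⟩))
    · exact isIrreducible_gradedPiece b j (by lia)
        (exists_rootCoeff_eq b ψ j (by lia) (abs_le.mpr ⟨by lia, by lia⟩))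
  independent := by
    have h : ![gradedPiece b j k, gradedPiece b j (k - rootCoeff b ψ j)] =
        adEigenModule (fundCoweight b j : L) ∘
          ![(k : ℂ), ((k - rootCoeff b ψ j : ℤ) : ℂ)] := by
      funext i
      fin_cases i <;> rfl
    have hn := hψ.rootCoeff_pos j
    have hne : (k : ℂ) ≠ ((k - rootCoeff b ψ j : ℤ) : ℂ) := by
      intro h
      have : k = k - rootCoeff b ψ j := by exact_mod_cast h
      lia
    rw [h]
    refine (iSupIndep_adEigenModule (fundCoweight b j : L)).comp ?_
    intro i i' h
    fin_cases i <;> fin_cases i'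
    · rfl
    · exact absurd h hne
    · exact absurd h.symm hne
    · rfl
  iSup_eq := by
    have hn := hψ.rootCoeff_pos j
    have hH := cartan_le_levi b j
    have hnd := Int.not_dvd_of_one_le_of_le hk hk'
    have hle {l : ℤ} (hl : l ≠ 0) (h : rootCoeff b ψ j ∣ l - k) : gradedPiece b j l ≤
        restrictTo (levi_le_fixedSubalgebra b ψ j) (adVertexEigen b ψ j k) := by
      refine le_of_rootSupport_subset hH _ (fun z hz hzH ↦ ?_) fun φ hφ ↦ ?_
      · rw [eq_zero_of_mem_gradedPiece b j hl hz hzH]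
        exact zero_mem _
      · rw [mem_rootSupport_gradedPiece b j] at hφ
        exact (mem_rootSupport_adVertexEigen b ψ j hn).mpr (by rwa [hφ])
    have hsup : ⨆ i, ![gradedPiece b j k, gradedPiece b j (k - rootCoeff b ψ j)] i =
        gradedPiece b j k ⊔ gradedPiece b j (k - rootCoeff b ψ j) := by
      refine le_antisymm (iSup_le fun i ↦ ?_) (sup_le ?_ ?_)
      · fin_cases i
        · exact le_sup_left
        · exact le_sup_right
      · exact le_iSup ![gradedPiece b j k, gradedPiece b j (k - rootCoeff b ψ j)] 0
      · exact le_iSup ![gradedPiece b j k, gradedPiece b j (k - rootCoeff b ψ j)] 1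
    rw [hsup]
    refine le_antisymm (sup_le (hle (by lia) (by simp)) (hle (by lia) ⟨-1, by ring⟩)) ?_
    refine le_of_rootSupport_subset hH _ (fun z hz hzH ↦ ?_) fun φ hφ ↦ ?_
    · rw [eq_zero_of_mem_adVertexEigen b ψ j hn hnd hz hzH]
      exact zero_mem _
    · replace hφ := (mem_rootSupport_adVertexEigen b ψ j hn).mp hφ
      rw [hψ.dvd_rootCoeff_sub_iff j hk hk'] at hφ
      rcases hφ with h | h
      · exact rootSupport_mono (H := H) (LieSubmodule.toSubmodule_le_toSubmodule _ _ |>.mpr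
          le_sup_left) ((mem_rootSupport_gradedPiece b j).mpr h)
      · exact rootSupport_mono (H := H) (LieSubmodule.toSubmodule_le_toSubmodule _ _ |>.mpr
          le_sup_right) ((mem_rootSupport_gradedPiece b j).mpr h)

end IsHighestRoot

/-- The bracket of two submodules of `𝔤`, as a submodule. -/
def bracketModule {L : Type*} [LieRing L] [LieAlgebra ℂ L] {K : LieSubalgebra ℂ L}
    (U W : LieSubmodule ℂ K L) : LieSubmodule ℂ K L where
  __ := bracketSpan U.toSubmodule W.toSubmodule
  lie_mem {x z} hz := by
    change ⁅(x : L), z⁆ ∈ bracketSpan U.toSubmodule W.toSubmodule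
    change z ∈ bracketSpan U.toSubmodule W.toSubmodule at hz
    induction hz using Submodule.span_induction with
    | mem z hz =>
      obtain ⟨u, hu, w, hw, rfl⟩ := hz
      rw [leibniz_lie]
      exact add_mem (Submodule.subset_span ⟨_, U.lie_mem (x := x) hu, w, hw, rfl⟩)
        (Submodule.subset_span ⟨u, hu, _, W.lie_mem (x := x) hw, rfl⟩)
    | zero => rw [lie_zero]; exact zero_mem _
    | add y z _ _ h1 h2 => rw [lie_add]; exact add_mem h1 h2
    | smul c z _ h => rw [lie_smul]; exact Submodule.smul_mem _ c h

/-! ### Brackets of eigenspaces, semisimplicity and maximality -/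

namespace IsHighestRoot

variable (hψ : IsHighestRoot b ψ) (j : b.support)
include hψ

theorem bracketSpan_adVertexEigen {p q r : ℤ} (hp : 1 ≤ p) (hp' : p ≤ rootCoeff b ψ j - 1)
    (hq : 1 ≤ q) (hq' : q ≤ rootCoeff b ψ j - 1) (hr : 1 ≤ r) (hr' : r ≤ rootCoeff b ψ j - 1)
    (h : rootCoeff b ψ j ∣ p + q - r) :
    bracketSpan (adVertexEigen b ψ j p).toSubmodule (adVertexEigen b ψ j q).toSubmodule =
      (adVertexEigen b ψ j r).toSubmodule := by
  have hn := hψ.rootCoeff_pos j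
  have hle : bracketSpan (adVertexEigen b ψ j p).toSubmodule (adVertexEigen b ψ j q).toSubmodule ≤
      (adVertexEigen b ψ j r).toSubmodule := by
    refine Submodule.span_le.mpr ?_
    rintro _ ⟨u, hu, w, hw, rfl⟩
    have hu' : adVertex b ψ j u = omega b ψ j ^ p • u := hu
    have hw' : adVertex b ψ j w = omega b ψ j ^ q • w := hw
    change adVertex b ψ j ⁅u, w⁆ = omega b ψ j ^ r • ⁅u, w⁆
    rw [LieEquiv.map_lie, hu', hw', smul_lie, lie_smul, smul_smul,
      ← (omega_zpow_eq_iff b ψ j hn _ _).mpr h,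
      zpow_add₀ (show omega b ψ j ≠ 0 from Complex.exp_ne_zero _)]
  have hpq : p + (q - rootCoeff b ψ j) ≠ 0 := by
    intro h0
    have : rootCoeff b ψ j ∣ r := by
      obtain ⟨c, hc⟩ := h
      exact ⟨1 - c, by linear_combination -hc + h0⟩
    exact Int.not_dvd_of_one_le_of_le hr hr' this
  -- The level q - n is used instead of q because opposite signs force a negative pairing, and hence
  -- a sum that is a root.
  obtain ⟨α, β, γ, hα, hβ, hγ⟩ := b.exists_root_eq_add_of_level j (k := p)
    (l := q - rootCoeff b ψ j) (by lia) (by lia) hpq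
    (exists_rootCoeff_eq b ψ j (by lia) (abs_le.mpr ⟨by lia, by lia⟩))
    (exists_rootCoeff_eq b ψ j (by lia) (abs_le.mpr ⟨by lia, by lia⟩))
  obtain ⟨x, hx, y, hy, hxy⟩ := exists_lie_ne_zero hγ
  have hx' : x ∈ adVertexEigen b ψ j p :=
    (mem_rootSupport_adVertexEigen b ψ j hn).mpr
      ((hψ.dvd_rootCoeff_sub_iff j hp hp' α).mpr (.inl hα)) hx
  have hy' : y ∈ adVertexEigen b ψ j q :=
    (mem_rootSupport_adVertexEigen b ψ j hn).mpr
      ((hψ.dvd_rootCoeff_sub_iff j hq hq' β).mpr (.inr hβ)) hy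
  have hmem : ⁅x, y⁆ ∈ bracketModule (adVertexEigen b ψ j p) (adVertexEigen b ψ j q) :=
    Submodule.subset_span ⟨x, hx', y, hy', rfl⟩
  refine le_antisymm hle ?_
  refine le_of_isIrreducible (N' := bracketModule (adVertexEigen b ψ j p) (adVertexEigen b ψ j q))
    (hψ.isIrreducible_adVertexEigen j hr hr') fun h0 ↦ hxy ?_
  exact (LieSubmodule.eq_bot_iff _).mp h0 _ ⟨hle hmem, hmem⟩

/-- The roots of 𝔤^{a_j} separate the points of 𝔥: they include every α_i with i ≠ j, and also ψ,
whose α_j-coefficient is nonzero. -/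
theorem isSpecial_adVertex : IsSpecial (adVertex b ψ j) := by
  classical
  have hn := hψ.rootCoeff_pos j
  have : HasTrivialRadical ℂ (fixedSubalgebra (adVertex b ψ j)) := by
    refine hasTrivialRadical_of_rootSupport (cartan_le_fixedSubalgebra b ψ j) ?_ ?_
    · intro φ hφ χ hχ
      rw [mem_rootSupport_fixedSubalgebra b ψ j hn] at hφ ⊢
      have := b.simpleCoeff_of_neg hχ j
      rw [simpleCoeff_eq_rootCoeff, simpleCoeff_eq_rootCoeff] at this
      rwa [this, dvd_neg]
    · intro x hx
      have hi (i : b.support) (hij : i ≠ j) : (rootSystem H).root i x = 0 := by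
        refine hx i ((mem_rootSupport_fixedSubalgebra b ψ j hn).mpr ?_)
        have h0 := b.simpleCoeff_simple i j
        rw [if_neg hij] at h0
        rw [show rootCoeff b i j = 0 from h0]
        exact dvd_zero _
      have hj : (rootSystem H).root j x = 0 := by
        have h1 := hx ψ ((mem_rootSupport_fixedSubalgebra b ψ j hn).mpr dvd_rfl)
        rw [root_eq_sum_rootCoeff b ψ, LinearMap.sum_apply, Finset.sum_eq_single j] at h1
        · rw [LinearMap.smul_apply, zsmul_eq_mul, mul_eq_zero] at h1
          exact h1.resolve_left (by exact_mod_cast hn.ne')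
        · intro i _ hij
          rw [LinearMap.smul_apply, hi i hij, smul_zero]
        · simp
      have hall (i : b.support) : (rootSystem H).root i x = 0 := by
        by_cases hij : i = j
        · rw [hij, hj]
        · exact hi i hij
      exact eq_zero_of_forall_simpleRoot_eq_zero b hall
  change IsSemisimple ℂ _
  infer_instance

theorem isCoatom_fixedSubalgebra (hprime : (rootCoeff b ψ j).toNat.Prime) :
    IsCoatom (fixedSubalgebra (adVertex b ψ j)) := by
  have hn := hψ.rootCoeff_pos j
  have hH := cartan_le_fixedSubalgebra b ψ j
  have hn2 : 2 ≤ rootCoeff b ψ j := by have := hprime.two_le; lia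
  have hprime' : Prime (rootCoeff b ψ j) := by
    rw [← Int.toNat_of_nonneg hn.le]
    exact Nat.prime_iff_prime_int.mp hprime
  constructor
  · intro htop
    obtain ⟨φ, hφ⟩ := exists_rootCoeff_eq b ψ j (k := 1) one_ne_zero (by rw [abs_one]; lia)
    have h1 : φ ∈ rootSupport H (fixedSubalgebra (adVertex b ψ j)).toSubmodule := by
      rw [htop]; exact fun _ _ ↦ trivial
    rw [mem_rootSupport_fixedSubalgebra b ψ j hn, hφ] at h1
    exact Int.not_dvd_of_one_le_of_le le_rfl (by lia) h1
  · intro S hS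
    let N : LieSubmodule ℂ (fixedSubalgebra (adVertex b ψ j)) L :=
      { S.toSubmodule with lie_mem := fun {x _} hz ↦ S.lie_mem (hS.le x.2) hz }
    obtain ⟨φ, hφS, hφ⟩ : ∃ φ ∈ rootSupport H N.toSubmodule,
        ¬ rootCoeff b ψ j ∣ rootCoeff b φ j := by
      by_contra! hc
      refine hS.not_ge ?_
      exact le_of_rootSupport_subset hH N (fun z _ hzH ↦ hH hzH)
        fun φ hφ ↦ (mem_rootSupport_fixedSubalgebra b ψ j hn).mpr (hc φ hφ)
    have hres {l : ℤ} (hl : ¬ rootCoeff b ψ j ∣ l) :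
        1 ≤ l % rootCoeff b ψ j ∧ l % rootCoeff b ψ j ≤ rootCoeff b ψ j - 1 := by
      have h1 := Int.emod_nonneg l hn.ne'
      have h2 := Int.emod_lt_of_pos l hn
      have h3 : l % rootCoeff b ψ j ≠ 0 := fun h ↦ hl (Int.dvd_of_emod_eq_zero h)
      exact ⟨by lia, by lia⟩
    set k := rootCoeff b φ j % rootCoeff b ψ j with hk
    obtain ⟨hk1, hk2⟩ := hres hφ
    have hkS : adVertexEigen b ψ j k ≤ N := by
      refine le_of_isIrreducible (hψ.isIrreducible_adVertexEigen j hk1 hk2) fun h0 ↦ ?_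
      obtain ⟨z, hz, hz0⟩ := exists_mem_rootSpace_ne_zero φ
      refine hz0 ((LieSubmodule.eq_bot_iff _).mp h0 z ⟨?_, hφS hz⟩)
      exact (mem_rootSupport_adVertexEigen b ψ j hn).mpr Int.dvd_self_sub_emod hz
    -- The multiple is (m + 1)k so that the base case is k itself. When (m + 1)k ≡ 0 the bracket
    -- theorem does not apply, but then (m + 2)k ≡ k.
    have hmul (m : ℕ) : ∀ r : ℤ, 1 ≤ r → r ≤ rootCoeff b ψ j - 1 →
        rootCoeff b ψ j ∣ (m + 1 : ℕ) * k - r → adVertexEigen b ψ j r ≤ N := by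
      induction m with
      | zero =>
        intro r hr hr' hdvd
        have h0 : r = k := by
          have := Int.eq_zero_of_abs_lt_dvd hdvd (by rw [abs_lt]; constructor <;> push_cast <;> lia)
          push_cast at this
          lia
        exact h0 ▸ hkS
      | succ m ih =>
        intro r hr hr' hdvd
        by_cases hm : rootCoeff b ψ j ∣ (m + 1 : ℕ) * k
        · have h0 : r = k := by
            have h1 : rootCoeff b ψ j ∣ k - r := by
              have := dvd_sub hdvd hm
              rwa [show ((m + 1 + 1 : ℕ) : ℤ) * k - r - (m + 1 : ℕ) * k = k - r by
                push_cast; ring] at this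
            have := Int.eq_zero_of_abs_lt_dvd h1 (by rw [abs_lt]; constructor <;> lia)
            lia
          exact h0 ▸ hkS
        · obtain ⟨hq1, hq2⟩ := hres hm
          have hq := ih _ hq1 hq2 Int.dvd_self_sub_emod
          have hbr := hψ.bracketSpan_adVertexEigen j hq1 hq2 hk1 hk2 hr hr' (by
            have h1 : rootCoeff b ψ j ∣
                ((m + 1 : ℕ) * k) - ((m + 1 : ℕ) * k) % rootCoeff b ψ j := Int.dvd_self_sub_emod
            have := dvd_sub hdvd h1
            rwa [show ((m + 1 + 1 : ℕ) : ℤ) * k - r -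
                ((m + 1 : ℕ) * k - ((m + 1 : ℕ) * k) % rootCoeff b ψ j) =
                ((m + 1 : ℕ) * k) % rootCoeff b ψ j + k - r by push_cast; ring] at this)
          intro z hz
          have hz' : z ∈ (adVertexEigen b ψ j r).toSubmodule := hz
          rw [← hbr] at hz'
          refine (Submodule.span_le (p := S.toSubmodule)).mpr ?_ hz'
          rintro _ ⟨u, hu, w, hw, rfl⟩
          exact S.lie_mem (hq hu) (hkS hw)
    have hcop : IsCoprime k (rootCoeff b ψ j) :=
      (hprime'.coprime_iff_not_dvd.mpr (Int.not_dvd_of_one_le_of_le hk1 hk2)).symm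
    obtain ⟨u, v, huv⟩ := hcop
    have htop : (⊤ : LieSubmodule ℂ (fixedSubalgebra (adVertex b ψ j)) L).toSubmodule ≤
        S.toSubmodule := by
      refine le_of_rootSupport_subset hH _ (fun z _ hzH ↦ hS.le (hH hzH)) fun χ _ ↦ ?_
      by_cases hχ : rootCoeff b ψ j ∣ rootCoeff b χ j
      · exact rootSupport_mono hS.le ((mem_rootSupport_fixedSubalgebra b ψ j hn).mpr hχ)
      · obtain ⟨hr1, hr2⟩ := hres hχ
        set r := rootCoeff b χ j % rootCoeff b ψ j with hr
        -- With u inverse to k mod n, choosing m ≡ ru - 1 gives (m + 1)k ≡ r.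
        have hm0 := Int.emod_nonneg (r * u - 1) hn.ne'
        obtain ⟨m, hm⟩ := Int.eq_ofNat_of_zero_le hm0
        have hle := hmul m r hr1 hr2 (by
          have h1 : rootCoeff b ψ j ∣ (r * u - 1) - (r * u - 1) % rootCoeff b ψ j :=
            Int.dvd_self_sub_emod
          rw [hm] at h1
          obtain ⟨c, hc⟩ := h1
          refine ⟨-c * k - r * v, ?_⟩
          push_cast
          linear_combination -k * hc + r * huv)
        exact rootSupport_mono (LieSubmodule.toSubmodule_le_toSubmodule _ _ |>.mpr hle)
          ((mem_rootSupport_adVertexEigen b ψ j hn).mpr Int.dvd_self_sub_emod)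
    exact eq_top_iff.mpr fun z _ ↦ htop (LieSubmodule.mem_top z)

end IsHighestRoot

end SpecialElement

/-! ### The vertex of the alcove -/

namespace SpecialElement.IsHighestRoot

variable {L : Type*} [LieRing L] [LieAlgebra ℂ L] [FiniteDimensional ℂ L] [IsSimple ℂ L]
  {H : LieSubalgebra ℂ L} [H.IsCartanSubalgebra] {b : (rootSystem H).Base} {ψ : H.root}

lemma root_alcoveVertex (φ : H.root) (j : b.support) :
    (rootSystem H).root φ (alcoveVertex b ψ j) =
      ((rootCoeff b φ j / rootCoeff b ψ j : ℝ) : ℂ) := by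
  rw [alcoveVertex, map_smul, root_apply_fundCoweight, smul_eq_mul, inv_mul_eq_div]
  push_cast
  rfl

lemma root_apply_of_forall_ne (φ : H.root) {j : b.support} {x : H}
    (h : ∀ i : b.support, i ≠ j → (rootSystem H).root i x = 0) :
    (rootSystem H).root φ x = rootCoeff b φ j * (rootSystem H).root j x := by
  rw [root_eq_sum_rootCoeff b φ, LinearMap.sum_apply, Finset.sum_eq_single j]
  · rw [LinearMap.smul_apply, zsmul_eq_mul]
  · intro i _ hij
    rw [LinearMap.smul_apply, h i hij, smul_zero]
  · simp

variable (hψ : IsHighestRoot b ψ) (j : b.support)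
include hψ

theorem alcoveVertex_mem_fundAlcove : alcoveVertex b ψ j ∈ fundAlcove b ψ := by
  classical
  have hn : (0 : ℝ) < rootCoeff b ψ j := by exact_mod_cast hψ.rootCoeff_pos j
  refine ⟨fun φ ↦ ?_, fun i ↦ ?_, ?_⟩
  · rw [root_alcoveVertex, Complex.ofReal_im]
  · rw [root_alcoveVertex, Complex.ofReal_re]
    refine div_nonneg ?_ hn.le
    have h := b.simpleCoeff_simple i j
    rw [show rootCoeff b i j = _ from h]
    split_ifs <;> simp
  · rw [root_alcoveVertex, Complex.ofReal_re, div_self hn.ne']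

/-- The only point of the alcove on the walls of all simple roots but `α_j` and on the wall of the
highest root is `v_j`. -/
lemma eq_alcoveVertex {x : H} (h : ∀ i : b.support, i ≠ j → (rootSystem H).root i x = 0)
    (h1 : (rootSystem H).root ψ x = 1) : x = alcoveVertex b ψ j := by
  classical
  have hn : (rootCoeff b ψ j : ℂ) ≠ 0 := by exact_mod_cast (hψ.rootCoeff_pos j).ne'
  have hv (i : b.support) (hij : i ≠ j) : (rootSystem H).root i (alcoveVertex b ψ j) = 0 := by
    rw [alcoveVertex, map_smul, root_fundCoweight_of_ne b i j hij, smul_zero]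
  refine sub_eq_zero.mp (eq_zero_of_forall_simpleRoot_eq_zero b fun i ↦ ?_)
  rw [map_sub]
  by_cases hij : i = j
  · rw [root_apply_of_forall_ne ψ h] at h1
    rw [hij, alcoveVertex, map_smul, root_fundCoweight_self, smul_eq_mul, mul_one, sub_eq_zero]
    exact eq_inv_of_mul_eq_one_right h1
  · rw [h i hij, hv i hij, sub_zero]

/-- The inequalities for the α_i, i ≠ j, and for ψ are equalities at v_j, hence at both ends of any
segment in the alcove with v_j in its interior. These equalities determine the point. -/
theorem alcoveVertex_mem_extremePoints :
    alcoveVertex b ψ j ∈ Set.extremePoints ℝ (fundAlcove b ψ) := by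
  classical
  refine mem_extremePoints.mpr ⟨hψ.alcoveVertex_mem_fundAlcove j, fun x hx y hy hxy ↦ ?_⟩
  obtain ⟨s, t, hs, ht, hst, hv⟩ := hxy
  have key (φ : H.root) : s * ((rootSystem H).root φ x).re + t * ((rootSystem H).root φ y).re =
      rootCoeff b φ j / rootCoeff b ψ j := by
    have h := congrArg (fun z ↦ ((rootSystem H).root φ z).re) hv
    simp only [root_alcoveVertex, Complex.ofReal_re] at h
    rw [← h, map_add, ← Complex.coe_smul, ← Complex.coe_smul, map_smul, map_smul]
    simp
  have hn : (rootCoeff b ψ j : ℝ) ≠ 0 := by exact_mod_cast (hψ.rootCoeff_pos j).ne'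
  have hi (i : b.support) (hij : i ≠ j) :
      ((rootSystem H).root i x).re = 0 ∧ ((rootSystem H).root i y).re = 0 := by
    have h := key i
    have h0 := b.simpleCoeff_simple i j
    rw [if_neg hij] at h0
    rw [show rootCoeff b i j = 0 from h0, Int.cast_zero, zero_div] at h
    have hx0 := hx.2.1 i
    have hy0 := hy.2.1 i
    have := (add_eq_zero_iff_of_nonneg (mul_nonneg hs.le hx0) (mul_nonneg ht.le hy0)).mp h
    exact ⟨(mul_eq_zero.mp this.1).resolve_left hs.ne',
      (mul_eq_zero.mp this.2).resolve_left ht.ne'⟩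
  have hψ1 : ((rootSystem H).root ψ x).re = 1 ∧ ((rootSystem H).root ψ y).re = 1 := by
    have h := key ψ
    rw [div_self hn] at h
    have hx1 := hx.2.2
    have hy1 := hy.2.2
    constructor <;> nlinarith
  -- The inequalities control real parts only; the imaginary parts vanish because both points lie in
  -- the real form.
  exact ⟨hψ.eq_alcoveVertex j (fun i hij ↦ Complex.ext (hi i hij).1 (hx.1 i))
      (Complex.ext hψ1.1 (hx.1 ψ)),
    hψ.eq_alcoveVertex j (fun i hij ↦ Complex.ext (hi i hij).2 (hy.1 i))
      (Complex.ext hψ1.2 (hy.1 ψ))⟩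

theorem levi_eq_elemCentralizer : levi b j = elemCentralizer (alcoveVertex b ψ j : L) := by
  have hn : (rootCoeff b ψ j : ℂ) ≠ 0 := by exact_mod_cast (hψ.rootCoeff_pos j).ne'
  ext z
  change ⁅(fundCoweight b j : L), z⁆ = 0 ↔
    ⁅(rootCoeff b ψ j : ℂ)⁻¹ • (fundCoweight b j : L), z⁆ = 0
  rw [smul_lie, smul_eq_zero_iff_right (inv_ne_zero hn)]

end SpecialElement.IsHighestRoot

/-! ### Counting the summands, and the theorem -/

lemma Int.natCard_one_le_le {n : ℤ} (hn : 0 < n) :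
    (Nat.card {k : ℤ // 1 ≤ k ∧ k ≤ n - 1} : ℤ) = n - 1 := by
  rw [Nat.subtype_card (Finset.Icc 1 (n - 1)) fun k ↦ Finset.mem_Icc, Int.card_Icc]
  lia

lemma Int.natCard_one_le_abs_le {n : ℤ} (hn : 0 < n) :
    (Nat.card {k : ℤ // 1 ≤ |k| ∧ |k| ≤ n - 1} : ℤ) = 2 * (n - 1) := by
  rw [Nat.subtype_card ((Finset.Icc (-(n - 1)) (n - 1)).erase 0) fun k ↦ by
      rw [Finset.mem_erase, Finset.mem_Icc, abs_le,
        show 1 ≤ |k| ↔ k ≠ 0 from ⟨fun h ↦ abs_pos.mp (by lia), Int.one_le_abs⟩],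
    Finset.card_erase_of_mem (Finset.mem_Icc.mpr ⟨by lia, by lia⟩), Int.card_Icc]
  lia

theorem theorem3p8 {L : Type*} [LieRing L] [LieAlgebra ℂ L] [FiniteDimensional ℂ L]
    [LieAlgebra.IsSimple ℂ L] (H : LieSubalgebra ℂ L) [H.IsCartanSubalgebra]
    (b : (LieAlgebra.IsKilling.rootSystem H).Base)
    (ψ : H.root) (hψ : IsHighestRoot b ψ) (j : b.support) :
    -- `v_j` is a vertex of the fundamental alcove, and `a_j = exp (2πi v_j)` is special
    alcoveVertex b ψ j ∈ Set.extremePoints ℝ (fundAlcove b ψ) ∧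
    IsSpecial (adVertex b ψ j) ∧
    -- if `n_j(ψ)` is prime, then `𝔤^{a_j}` is a maximal proper subalgebra
    ((rootCoeff b ψ j).toNat.Prime →
      IsCoatom (fixedSubalgebra (adVertex b ψ j))) ∧
    -- `𝔪[j]` is the centralizer of `v_j`, and it is contained in `𝔤^{a_j}`
    levi b j =
      elemCentralizer (alcoveVertex b ψ j : L) ∧
    levi b j ≤
      fixedSubalgebra (adVertex b ψ j) ∧
    -- `𝔯[j]` under `𝔪[j]`
    IsMultiplicityFree (levi b j)
      (restrictTo (levi_le_fixedSubalgebra b ψ j)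
        (vertexOrtho b ψ j)) ∧
    IsIrreducibleDecomposition
      (restrictTo (levi_le_fixedSubalgebra b ψ j)
        (vertexOrtho b ψ j))
      (fun k : {k : ℤ // 1 ≤ |k| ∧ |k| ≤ rootCoeff b ψ j - 1} =>
        gradedPiece b j k) ∧
    (Nat.card {k : ℤ // 1 ≤ |k| ∧ |k| ≤ rootCoeff b ψ j - 1} : ℤ) =
      2 * (rootCoeff b ψ j - 1) ∧
    -- the eigenspaces of `Ad a_j` under `𝔪[j]`
    (∀ k : ℤ, 1 ≤ k → k ≤ rootCoeff b ψ j - 1 →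
      IsIrreducibleDecomposition
        (restrictTo (levi_le_fixedSubalgebra b ψ j)
          (adVertexEigen b ψ j k))
        ![gradedPiece b j k,
          gradedPiece b j (k - rootCoeff b ψ j)]) ∧
    -- the eigenspaces of `Ad a_j` under `𝔤^{a_j}`
    (∀ k : ℤ, 1 ≤ k → k ≤ rootCoeff b ψ j - 1 →
      LieModule.IsIrreducible ℂ (fixedSubalgebra (adVertex b ψ j))
        (adVertexEigen b ψ j k)) ∧
    -- `𝔯[j]` under `𝔤^{a_j}`
    IsMultiplicityFree
      (fixedSubalgebra (adVertex b ψ j))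
      (vertexOrtho b ψ j) ∧
    IsIrreducibleDecomposition (vertexOrtho b ψ j)
      (fun k : {k : ℤ // 1 ≤ k ∧ k ≤ rootCoeff b ψ j - 1} =>
        adVertexEigen b ψ j k) ∧
    (Nat.card {k : ℤ // 1 ≤ k ∧ k ≤ rootCoeff b ψ j - 1} : ℤ) =
      rootCoeff b ψ j - 1 ∧
    -- brackets of the eigenspaces
    (∀ p q r : ℤ, 1 ≤ p → p ≤ rootCoeff b ψ j - 1 →
      1 ≤ q → q ≤ rootCoeff b ψ j - 1 →
      1 ≤ r → r ≤ rootCoeff b ψ j - 1 →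
      r ≡ p + q [ZMOD rootCoeff b ψ j] →
      bracketSpan (adVertexEigen b ψ j p).toSubmodule
        (adVertexEigen b ψ j q).toSubmodule =
      (adVertexEigen b ψ j r).toSubmodule) := by
  have hn := hψ.rootCoeff_pos j
  exact ⟨hψ.alcoveVertex_mem_extremePoints j, hψ.isSpecial_adVertex j,
    hψ.isCoatom_fixedSubalgebra j, hψ.levi_eq_elemCentralizer j, levi_le_fixedSubalgebra b ψ j,
    hψ.isMultiplicityFree_levi_vertexOrtho j, hψ.isIrreducibleDecomposition_levi_vertexOrtho j,
    Int.natCard_one_le_abs_le hn,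
    fun _ hk hk' ↦ hψ.isIrreducibleDecomposition_levi_adVertexEigen j hk hk',
    fun _ hk hk' ↦ hψ.isIrreducible_adVertexEigen j hk hk',
    hψ.isMultiplicityFree_vertexOrtho j, hψ.isIrreducibleDecomposition_vertexOrtho j,
    Int.natCard_one_le_le hn,
    fun _ _ _ hp hp' hq hq' hr hr' h ↦
      hψ.bracketSpan_adVertexEigen j hp hp' hq hq' hr hr' h.dvd⟩
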